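/- Let $n,m\ge 0$ be integers and let $q\in\mathbb{C}[z,w]$ be a polynomial of degree $(n,m)$, i.e. of degree exactly $n$ in $z$ and exactly $m$ in $w$. Suppose that $q$ is $\mathbb{T}^2$-symmetric, i.e. $q(z,w)=z^n w^m\,\overline{q(1/\bar z,1/\bar w)}$ for all $z,w\in\mathbb{C}\setminus\{0\}$, and that $q$ has no zeros on the open bidisk $\mathbb{D}^2=\{(z,w)\in\mathbb{C}^2:|z|<1,\ |w|<1\}$. Let $a,b\ge 0$ be real numbers, not both zero, and write $q_z=\partial q/\partial z$, $q_w=\partial q/\partial w$. Then there exist a $\mathbb{C}^n$-valued polynomial $\vec A=(A_1,\dots,A_n)$, each component of which has degree at most $n-1$ in $z$ and at most $m$ in $w$, and a $\mathbb{C}^m$-valued polynomial $\vec B=(B_1,\dots,B_m)$, each component of which has degree at most $n$ in $z$ and at most $m-1$ in $w$, such that for all $(z,w)\in\mathbb{C}^2$ $$(an+bm)\,|q(z,w)|^2-2\,\mathrm{Re}\Big(\big(a z\,q_z(z,w)+b w\,q_w(z,w)\big)\overline{q(z,w)}\Big)=(1-|z|^2)\,|\vec A(z,w)|^2+(1-|w|^2)\,|\vec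 B(z,w)|^2,$$ where $|\cdot|$ on vectors is the Euclidean length (an empty vector has length $0$). Furthermore, suppose that $q$ is squarefree (a product of distinct irreducible factors) and, in the degenerate cases, that $q$ has no nonconstant factor depending on $z$ alone if $a=0$, and no nonconstant factor depending on $w$ alone if $b=0$. Then any such $\vec A$ and $\vec B$ have at most finitely many common zeros on $Z_q=\{(z,w)\in\mathbb{C}^2:q(z,w)=0\}$. -/

import Mathlib

open MvPolynomial

namespace BidiskSOS

/-- Two-variable complex polynomials: variable `0` is `z`, variable `1` is `w`. -/
abbrev Poly2 := MvPolynomial (Fin 2) ℂ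

/-- The value `p(z, w)`. -/
noncomputable def ev (p : Poly2) (z w : ℂ) : ℂ := eval ![z, w] p

/-- `p` has degree (exactly) `(n, m)`: degree `n` in `z` and degree `m` in `w`. -/
def HasDegree (p : Poly2) (n m : ℕ) : Prop := degreeOf 0 p = n ∧ degreeOf 1 p = m

/-- `p` has degree at most `(n, m)`. -/
def DegreeAtMost (p : Poly2) (n m : ℕ) : Prop := degreeOf 0 p ≤ n ∧ degreeOf 1 p ≤ m

/-- The reflection of `p` at the degree `(n, m)`, as a function of `z, w ≠ 0`:
`z ^ n * w ^ m * conj (p (1 / conj z, 1 / conj w))`. -/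
noncomputable def reflection (p : Poly2) (n m : ℕ) (z w : ℂ) : ℂ :=
  z ^ n * w ^ m * star (ev p (1 / star z) (1 / star w))

/-- `p`, of degree at most `(n, m)`, is `𝕋²`-symmetric: it equals its reflection at the degree
`(n, m)`. (Two polynomials that agree wherever `z, w ≠ 0` are equal.) -/
def IsTorusSymmetric (p : Poly2) (n m : ℕ) : Prop :=
  ∀ z w : ℂ, z ≠ 0 → w ≠ 0 → ev p z w = reflection p n m z w

/-- `p` has no zeros on the open bidisk `𝔻²`. -/
def NoZerosOnBidisk (p : Poly2) : Prop :=
  ∀ z w : ℂ, ‖z‖ < 1 → ‖w‖ < 1 → ev p z w ≠ 0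

/-- The squared Euclidean length of the vector `(P₁(z, w), …, P_k(z, w))`. -/
noncomputable def vecNormSq {k : ℕ} (P : Fin k → Poly2) (z w : ℂ) : ℝ :=
  ∑ i, ‖ev (P i) z w‖ ^ 2

/-- `A` is a `ℂⁿ`-valued polynomial of degree at most `(n-1, m)`, `B` is a `ℂᵐ`-valued polynomial
of degree at most `(n, m-1)`, and the sum of squares formula for `q` with parameters `a, b` holds
on `ℂ²`. (Components of `A` exist only if `n ≥ 1`, components of `B` only if `m ≥ 1`, so the
subtractions never truncate.) -/
def IsSOSPair (q : Poly2) (n m : ℕ) (a b : ℝ) (A : Fin n → Poly2) (B : Fin m → Poly2) : Prop :=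
  (∀ i, DegreeAtMost (A i) (n - 1) m) ∧
  (∀ j, DegreeAtMost (B j) n (m - 1)) ∧
  ∀ z w : ℂ,
    (a * n + b * m) * ‖ev q z w‖ ^ 2
      - 2 * (((a : ℂ) * z * ev (pderiv 0 q) z w + (b : ℂ) * w * ev (pderiv 1 q) z w)
          * star (ev q z w)).re
    = (1 - ‖z‖ ^ 2) * vecNormSq A z w + (1 - ‖w‖ ^ 2) * vecNormSq B z w

/-- The common zeros of `A` and `B` on the zero set `Z_q ⊆ ℂ²` of `q`. -/
def commonZeros (q : Poly2) {n m : ℕ} (A : Fin n → Poly2) (B : Fin m → Poly2) : Set (ℂ × ℂ) :=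
  {x | ev q x.1 x.2 = 0 ∧ (∀ i, ev (A i) x.1 x.2 = 0) ∧ ∀ j, ev (B j) x.1 x.2 = 0}

end BidiskSOS

/-! Existence. For `p` without zeros on the closed bidisk, with reflection `r` at degree `(n, m)`,
the Christoffel–Darboux formula writes `|p|² - |r|²` as a sum of squares of the required shape
(`exists_christoffelDarboux`). Apply it to the dilation `q(e^{-as} z, e^{-bs} w)`, `a, b, s > 0`. By
the symmetry of `q` its reflection is `e^{-(an+bm)s} q(e^{as} z, e^{bs} w)`, so `|p|² - |r|²`
vanishes at `s = 0` and its derivative there is twice the left side of the claim. Sums of squares of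
fixed degree are closed under pointwise limits (`IsBidiskSumSq.of_tendsto`); hence the derivative is
one too, and a second limit admits `a = 0` or `b = 0`.

The formula itself is geometry in the polynomials with the inner product of `L²(𝕋², 1/|p|²)`. Let
`V`, `W`, `X` be the polynomials of degree at most `(n-1, m)`, `(n, m-1)`, `(n-1, m-1)`. The crucial
fact is that `V ⊖ X` is orthogonal to all of `W`, not merely to `X`
(`StablePair.inner_eq_zero_of_le`). It gives inclusion–exclusion for the diagonal reproducing
kernels of `V + W` and of `zV + wW`. These spaces are the orthogonal complements of `r` and of `p`
in the polynomials of degree at most `(n, m)`, and comparing the kernels yields the formula.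

Finiteness. Let `D = a z ∂/∂z + b w ∂/∂w`. Differentiating the identity at a common zero of `q`,
`A`, `B` shows that `Dq` vanishes there (`ev_eulerDerivation_eq_zero`). An irreducible common factor
`f` of `q` and `Dq` would divide `Df`, since `q` is squarefree. As `f(0, 0) ≠ 0` this forces `Df =
0`, so `f` depends only on a variable of weight zero, which is excluded (`not_dvd_eulerDerivation`).
Thus `q` and `Dq` share no factor, and resultants leave finitely many common zeros. -/

namespace BidiskSOS

/-! ### Diagonal reproducing kernels and orthogonal decompositions. -/

section ReproducingNorm

open Module Submodule
open scoped InnerProductSpace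

variable {E : Type*} [NormedAddCommGroup E] [InnerProductSpace ℂ E]

/-- The squared norm of the restriction of the functional `φ` to the finite-dimensional
subspace `M`. -/
noncomputable def functionalNormSq (φ : E →ₗ[ℂ] ℂ) (M : Submodule ℂ E) [FiniteDimensional ℂ M] :
    ℝ :=
  ∑ i, ‖φ (stdOrthonormalBasis ℂ M i)‖ ^ 2

/-- By Riesz `φ = ⟪k, ·⟫`, and Parseval identifies both sums with `‖k‖²`. -/
lemma sum_norm_sq_eq_of_orthonormalBasis {F : Type*} [NormedAddCommGroup F]
    [InnerProductSpace ℂ F] [FiniteDimensional ℂ F] (φ : F →ₗ[ℂ] ℂ) {ι κ : Type*} [Fintype ι]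
    [Fintype κ] (b : OrthonormalBasis ι ℂ F) (c : OrthonormalBasis κ ℂ F) :
    ∑ i, ‖φ (b i)‖ ^ 2 = ∑ i, ‖φ (c i)‖ ^ 2 := by
  have := FiniteDimensional.complete ℂ F
  set k := (InnerProductSpace.toDual ℂ F).symm (LinearMap.toContinuousLinearMap φ)
  have hk (x : F) : φ x = ⟪k, x⟫_ℂ := by simp [k]
  simp only [hk]
  rw [b.sum_sq_norm_inner_left, c.sum_sq_norm_inner_left]

lemma functionalNormSq_eq_of_orthonormal (φ : E →ₗ[ℂ] ℂ) {ι : Type*} [Fintype ι] {e : ι → E}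
    (he : Orthonormal ℂ e) (M : Submodule ℂ E) [FiniteDimensional ℂ M]
    (hM : span ℂ (Set.range e) = M) : functionalNormSq φ M = ∑ i, ‖φ (e i)‖ ^ 2 := by
  subst hM
  let v : ι → span ℂ (Set.range e) := fun i => ⟨e i, subset_span ⟨i, rfl⟩⟩
  have hv : Orthonormal ℂ v := by
    rw [← (span ℂ (Set.range e)).subtypeₗᵢ.orthonormal_comp_iff]
    exact he
  have hs : ⊤ ≤ span ℂ (Set.range v) := by
    rintro ⟨x, hx⟩ -
    have : x ∈ (span ℂ (Set.range v)).map (span ℂ (Set.range e)).subtype := by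
      rw [Submodule.map_span, ← Set.range_comp]
      exact hx
    obtain ⟨y, hy, rfl⟩ := this
    exact hy
  have := sum_norm_sq_eq_of_orthonormalBasis (φ ∘ₗ (span ℂ (Set.range e)).subtype)
    (stdOrthonormalBasis ℂ _) (OrthonormalBasis.mk hv hs)
  simpa [functionalNormSq, v] using this

lemma span_range_stdOrthonormalBasis (M : Submodule ℂ E) [FiniteDimensional ℂ M] :
    span ℂ (Set.range fun i => (stdOrthonormalBasis ℂ M i : E)) = M := by
  have h := congrArg (Submodule.map M.subtype) (stdOrthonormalBasis ℂ M).toBasis.span_eq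
  rw [Submodule.map_span, ← Set.range_comp] at h
  simpa [Function.comp_def] using h

lemma orthonormal_coe_stdOrthonormalBasis (M : Submodule ℂ E) [FiniteDimensional ℂ M] :
    Orthonormal ℂ fun i => (stdOrthonormalBasis ℂ M i : E) :=
  M.subtypeₗᵢ.orthonormal_comp_iff.2 (stdOrthonormalBasis ℂ M).orthonormal

lemma functionalNormSq_congr (φ : E →ₗ[ℂ] ℂ) {M N : Submodule ℂ E} [FiniteDimensional ℂ M]
    [FiniteDimensional ℂ N] (h : M = N) : functionalNormSq φ M = functionalNormSq φ N := by
  subst h; rfl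

lemma functionalNormSq_sup (φ : E →ₗ[ℂ] ℂ) (M N : Submodule ℂ E) [FiniteDimensional ℂ M]
    [FiniteDimensional ℂ N] (h : ∀ x ∈ M, ∀ y ∈ N, ⟪x, y⟫_ℂ = 0) :
    functionalNormSq φ (M ⊔ N) = functionalNormSq φ M + functionalNormSq φ N := by
  have hM := orthonormal_coe_stdOrthonormalBasis M
  have hN := orthonormal_coe_stdOrthonormalBasis N
  have ho : Orthonormal ℂ (Sum.elim (fun i => (stdOrthonormalBasis ℂ M i : E))
      (fun i => (stdOrthonormalBasis ℂ N i : E))) := by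
    refine ⟨?_, ?_⟩
    · rintro (i | i)
      · exact hM.1 i
      · exact hN.1 i
    · rintro (i | i) (j | j) hij
      · exact hM.2 fun h => hij (by rw [h])
      · exact h _ (coe_mem _) _ (coe_mem _)
      · exact inner_eq_zero_symm.1 (h _ (coe_mem _) _ (coe_mem _))
      · exact hN.2 fun h => hij (by rw [h])
  rw [functionalNormSq_eq_of_orthonormal φ ho, Fintype.sum_sum_type]
  · rfl
  · rw [Set.Sum.elim_range, span_union, span_range_stdOrthonormalBasis,
      span_range_stdOrthonormalBasis]

lemma functionalNormSq_map (φ : E →ₗ[ℂ] ℂ) (T : E →ₗᵢ[ℂ] E) (c : ℂ) (hT : ∀ x, φ (T x) = c * φ x)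
    (M : Submodule ℂ E) [FiniteDimensional ℂ M] :
    functionalNormSq φ (M.map T.toLinearMap) = ‖c‖ ^ 2 * functionalNormSq φ M := by
  have hM := (orthonormal_coe_stdOrthonormalBasis M).comp_linearIsometry T
  rw [functionalNormSq_eq_of_orthonormal φ hM, functionalNormSq, Finset.mul_sum]
  · simp [hT, mul_pow]
  · conv_rhs => rw [← span_range_stdOrthonormalBasis M, Submodule.map_span, ← Set.range_comp]
    rfl

lemma functionalNormSq_span_singleton (φ : E →ₗ[ℂ] ℂ) {p : E} (hp : ‖p‖ = 1) :
    functionalNormSq φ (span ℂ {p}) = ‖φ p‖ ^ 2 := by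
  have : Orthonormal ℂ (fun _ : Unit => p) := by
    refine ⟨fun _ => hp, fun i j hij => (hij (Subsingleton.elim _ _)).elim⟩
  rw [functionalNormSq_eq_of_orthonormal φ this _ (by simp)]
  simp

/-- The hypothesis turns `V ⊔ W` into the orthogonal sum of `W` and `V ⊖ X`, while `V` is that of
`X` and `V ⊖ X`; the contribution of `V ⊖ X` cancels. -/
lemma functionalNormSq_sup_add (φ : E →ₗ[ℂ] ℂ) (V W X : Submodule ℂ E) [FiniteDimensional ℂ V]
    [FiniteDimensional ℂ W] [FiniteDimensional ℂ X] (hV : X ≤ V) (hW : X ≤ W)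
    (h : ∀ f ∈ V, (∀ g ∈ X, ⟪g, f⟫_ℂ = 0) → ∀ g ∈ W, ⟪g, f⟫_ℂ = 0) :
    functionalNormSq φ (V ⊔ W) + functionalNormSq φ X
      = functionalNormSq φ V + functionalNormSq φ W := by
  have hd := sup_orthogonal_inf_of_hasOrthogonalProjection hV
  have h1 := functionalNormSq_sup φ X (Xᗮ ⊓ V) fun x hx y hy => hy.1 x hx
  have h2 := functionalNormSq_sup φ W (Xᗮ ⊓ V) fun x hx y hy => h y hy.2 hy.1 x hx
  rw [functionalNormSq_congr φ hd] at h1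
  have : W ⊔ Xᗮ ⊓ V = V ⊔ W := by
    rw [← hd, sup_right_comm, sup_eq_right.2 hW]
    rw [hd]
  rw [functionalNormSq_congr φ this] at h2
  linarith

/-- A sum of squares formula from two orthogonal decompositions of the same space. -/
theorem exists_sum_sq_of_orthogonal_decompositions (S T : E →ₗᵢ[ℂ] E) (V W X : Submodule ℂ E)
    [FiniteDimensional ℂ V] [FiniteDimensional ℂ W] [FiniteDimensional ℂ X] (n m : ℕ)
    (hXV : X ≤ V) (hXW : X ≤ W) (hSX : X.map S.toLinearMap ≤ W)
    (hST : X.map (S.comp T).toLinearMap ≤ W.map T.toLinearMap)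
    (hSTV : X.map (S.comp T).toLinearMap ≤ V.map S.toLinearMap)
    (hn : finrank ℂ X + n = finrank ℂ V) (hm : finrank ℂ X + m = finrank ℂ W)
    (horth : ∀ f ∈ V, (∀ g ∈ X, ⟪g, f⟫_ℂ = 0) → ∀ g ∈ W, ⟪g, f⟫_ℂ = 0)
    (horth' : ∀ f ∈ V.map S.toLinearMap, (∀ g ∈ X.map (S.comp T).toLinearMap, ⟪g, f⟫_ℂ = 0) →
      ∀ g ∈ W.map T.toLinearMap, ⟪g, f⟫_ℂ = 0)
    (p r : E) (hp : ‖p‖ = 1) (hr : ‖r‖ = 1)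
    (hpo : ∀ g ∈ V.map S.toLinearMap ⊔ W.map T.toLinearMap, ⟪p, g⟫_ℂ = 0)
    (hro : ∀ g ∈ V ⊔ W, ⟪r, g⟫_ℂ = 0)
    (hspan : span ℂ {p} ⊔ (V.map S.toLinearMap ⊔ W.map T.toLinearMap)
      = span ℂ {r} ⊔ (V ⊔ W)) :
    ∃ (A : Fin n → E) (B : Fin m → E), (∀ i, A i ∈ V) ∧ (∀ j, B j ∈ W) ∧
      ∀ (φ : E →ₗ[ℂ] ℂ) (z w : ℂ), (∀ f, φ (S f) = z * φ f) → (∀ f, φ (T f) = w * φ f) →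
        ‖φ p‖ ^ 2 - ‖φ r‖ ^ 2
          = (1 - ‖z‖ ^ 2) * ∑ i, ‖φ (A i)‖ ^ 2 + (1 - ‖w‖ ^ 2) * ∑ j, ‖φ (B j)‖ ^ 2 := by
  have key (Y U : Submodule ℂ E) (k : ℕ) [FiniteDimensional ℂ Y] [FiniteDimensional ℂ U]
      (hY : Y ≤ U) (hk : finrank ℂ Y + k = finrank ℂ U) : ∃ A : Fin k → E, (∀ i, A i ∈ U) ∧
        ∀ φ : E →ₗ[ℂ] ℂ, functionalNormSq φ U = functionalNormSq φ Y + ∑ i, ‖φ (A i)‖ ^ 2 := by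
    have hd := sup_orthogonal_inf_of_hasOrthogonalProjection hY
    have hf : finrank ℂ (Yᗮ ⊓ U : Submodule ℂ E) = k := finrank_add_inf_finrank_orthogonal' hY hk
    refine ⟨fun i => (stdOrthonormalBasis ℂ (Yᗮ ⊓ U : Submodule ℂ E) (finCongr hf.symm i) : E),
      fun i => (coe_mem (stdOrthonormalBasis ℂ (Yᗮ ⊓ U : Submodule ℂ E) _)).2, fun φ => ?_⟩
    have h1 := functionalNormSq_sup φ Y (Yᗮ ⊓ U) fun x hx y hy => hy.1 x hx
    rw [functionalNormSq_congr φ hd] at h1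
    rw [h1, functionalNormSq, functionalNormSq]
    congr 1
    exact (Equiv.sum_comp (finCongr hf.symm) fun i =>
      ‖φ (stdOrthonormalBasis ℂ (Yᗮ ⊓ U : Submodule ℂ E) i : E)‖ ^ 2).symm
  -- `A` is an orthonormal basis of `V ⊖ X`, but `B` is one of `W ⊖ S X`. This asymmetry is what
  -- makes the kernel of `X` cancel at the end: `(1 - |z|²) + (1 - |w|²)|z|² = 1 - |zw|²`.
  obtain ⟨A, hA, hA'⟩ := key X V n hXV hn
  obtain ⟨B, hB, hB'⟩ := key (X.map S.toLinearMap) W m hSX (by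
    rw [← (X.equivMapOfInjective S.toLinearMap S.injective).finrank_eq]; exact hm)
  refine ⟨A, B, hA, hB, fun φ z w hz hw => ?_⟩
  have e1 := functionalNormSq_sup_add φ V W X hXV hXW horth
  have e2 := functionalNormSq_sup_add φ _ _ _ hSTV hST horth'
  have hsing (x : E) (M : Submodule ℂ E) (hx : ∀ g ∈ M, ⟪x, g⟫_ℂ = 0) :
      ∀ y ∈ span ℂ {x}, ∀ g ∈ M, ⟪y, g⟫_ℂ = 0 := by
    intro y hy g hg
    obtain ⟨c, rfl⟩ := mem_span_singleton.1 hy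
    rw [inner_smul_left, hx g hg, mul_zero]
  have e3 := functionalNormSq_sup φ _ _ (hsing p _ hpo)
  have e4 := functionalNormSq_sup φ _ _ (hsing r _ hro)
  rw [functionalNormSq_congr φ hspan, e4, functionalNormSq_span_singleton φ hp,
    functionalNormSq_span_singleton φ hr] at e3
  rw [functionalNormSq_map φ (S.comp T) (z * w) (fun x => by
      rw [LinearIsometry.coe_comp, Function.comp_apply, hz, hw, mul_assoc]), functionalNormSq_map φ S z hz,
    functionalNormSq_map φ T w hw, norm_mul, mul_pow] at e2
  have hB'' := hB' φ
  rw [functionalNormSq_map φ S z hz] at hB''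
  have hA'' := hA' φ
  linear_combination (-e3) + e1 - e2 + (1 - ‖z‖ ^ 2) * hA'' + (1 - ‖w‖ ^ 2) * hB''

end ReproducingNorm

/-! ### Fourier analysis on the torus. -/

section Torus

open MeasureTheory UnitAddTorus Submodule
open scoped InnerProductSpace ENNReal

/-- Continuous functions on the torus `𝕋²`. -/
abbrev TorusFun := C(UnitAddTorus (Fin 2), ℂ)

/-- The monomial `z ^ k.1 * w ^ k.2` as a function on the torus. -/
noncomputable def torusMonomial (k : ℤ × ℤ) : TorusFun := mFourier ![k.1, k.2]

/-- The normalized Lebesgue measure on the torus. -/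
noncomputable abbrev torusMeasure : Measure (UnitAddTorus (Fin 2)) :=
  Measure.pi fun _ => AddCircle.haarAddCircle

/-- The inclusion of the continuous functions into `L²` of the torus. -/
noncomputable def toL2 : TorusFun →L[ℂ] Lp ℂ 2 torusMeasure :=
  ContinuousMap.toLp 2 torusMeasure ℂ

/-- The mean value of a continuous function on the torus. -/
noncomputable def torusMean : TorusFun →L[ℂ] ℂ := (innerSL ℂ (toL2 1)).comp toL2

lemma torusMean_apply (g : TorusFun) : torusMean g = ∫ x, g x ∂torusMeasure := by
  simp [torusMean, toL2, ContinuousMap.inner_toLp]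

lemma inner_toL2 (g h : TorusFun) : ⟪toL2 g, toL2 h⟫_ℂ = torusMean (star g * h) := by
  rw [torusMean_apply, toL2, ContinuousMap.inner_toLp]
  simp [mul_comm]

lemma torusMean_star (g : TorusFun) : torusMean (star g) = star (torusMean g) := by
  rw [torusMean_apply, torusMean_apply]
  exact integral_conj

lemma torusMonomial_mul (k l : ℤ × ℤ) :
    torusMonomial k * torusMonomial l = torusMonomial (k + l) := by
  ext x
  have : ![(k + l).1, (k + l).2] = ![k.1, k.2] + ![l.1, l.2] := by simp
  rw [torusMonomial, torusMonomial, torusMonomial, this, mFourier_add]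
  rfl

lemma star_torusMonomial (k : ℤ × ℤ) : star (torusMonomial k) = torusMonomial (-k) := by
  ext x
  have : ![(-k).1, (-k).2] = -![k.1, k.2] := by simp
  rw [torusMonomial, torusMonomial, this, mFourier_neg]
  rfl

@[simp] lemma torusMonomial_zero : torusMonomial 0 = 1 := by
  have : (![(0 : ℤ × ℤ).1, (0 : ℤ × ℤ).2] : Fin 2 → ℤ) = 0 := by simp
  rw [torusMonomial, this, mFourier_zero]

lemma torusMean_torusMonomial (k : ℤ × ℤ) :
    torusMean (torusMonomial k) = if k = 0 then 1 else 0 := by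
  have h : ⟪toL2 (mFourier 0), toL2 (mFourier ![k.1, k.2])⟫_ℂ
      = if (0 : Fin 2 → ℤ) = ![k.1, k.2] then 1 else 0 :=
    orthonormal_iff_ite.1 (orthonormal_mFourier (d := Fin 2)) 0 ![k.1, k.2]
  have h2 : ((0 : Fin 2 → ℤ) = ![k.1, k.2]) ↔ k = 0 := by
    rw [eq_comm, Prod.ext_iff, _root_.funext_iff, Fin.forall_fin_two]; rfl
  rw [mFourier_zero] at h
  simp only [h2] at h
  exact h

lemma norm_torusMonomial (k : ℤ × ℤ) : ‖torusMonomial k‖ = 1 := mFourier_norm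

/-- Trigonometric polynomials with exponents in `s`. -/
noncomputable def trigSupported (s : Set (ℤ × ℤ)) : Submodule ℂ TorusFun :=
  span ℂ (torusMonomial '' s)

lemma torusMonomial_mem {s : Set (ℤ × ℤ)} {k : ℤ × ℤ} (hk : k ∈ s) :
    torusMonomial k ∈ trigSupported s := subset_span ⟨k, hk, rfl⟩

lemma trigSupported_mono {s t : Set (ℤ × ℤ)} (h : s ⊆ t) : trigSupported s ≤ trigSupported t :=
  span_mono (Set.image_mono h)

lemma trigSupported_le {s : Set (ℤ × ℤ)} {N : Submodule ℂ TorusFun}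
    (h : ∀ k ∈ s, torusMonomial k ∈ N) : trigSupported s ≤ N := by
  rw [trigSupported, span_le]
  rintro _ ⟨k, hk, rfl⟩
  exact h k hk

lemma mul_mem_trigSupported {s t u : Set (ℤ × ℤ)} {g h : TorusFun} (hg : g ∈ trigSupported s)
    (hh : h ∈ trigSupported t) (hu : ∀ k ∈ s, ∀ l ∈ t, k + l ∈ u) : g * h ∈ trigSupported u := by
  have h1 := mul_mem_mul hg hh
  rw [trigSupported, trigSupported, span_mul_span] at h1
  refine span_le.2 ?_ h1
  rintro _ ⟨_, ⟨k, hk, rfl⟩, _, ⟨l, hl, rfl⟩, rfl⟩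
  simp only [torusMonomial_mul]
  exact torusMonomial_mem (hu k hk l hl)

lemma star_mem_trigSupported {s u : Set (ℤ × ℤ)} {g : TorusFun} (hg : g ∈ trigSupported s)
    (hu : ∀ k ∈ s, -k ∈ u) : star g ∈ trigSupported u := by
  induction hg using span_induction with
  | mem x hx =>
    obtain ⟨k, hk, rfl⟩ := hx
    rw [star_torusMonomial]
    exact torusMonomial_mem (hu k hk)
  | zero => simp
  | add x y _ _ hx hy => rw [star_add]; exact add_mem hx hy
  | smul a x _ hx => rw [star_smul]; exact smul_mem _ _ hx

lemma exists_add_of_mem_trigSupported {s t u : Set (ℤ × ℤ)} {g : TorusFun}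
    (hg : g ∈ trigSupported s) (h : s ⊆ t ∪ u) :
    ∃ g₁ ∈ trigSupported t, ∃ g₂ ∈ trigSupported u, g₁ + g₂ = g := by
  have := trigSupported_mono h hg
  rwa [trigSupported, Set.image_union, span_union, mem_sup] at this

lemma linearIndependent_torusMonomial : LinearIndependent ℂ torusMonomial := by
  have h : LinearIndependent ℂ (toL2 ∘ torusMonomial) := by
    refine (orthonormal_iff_ite.2 fun k l => ?_ : Orthonormal ℂ _).linearIndependent
    rw [Function.comp_apply, Function.comp_apply, inner_toL2, star_torusMonomial,
      torusMonomial_mul, torusMean_torusMonomial]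
    simp [neg_add_eq_zero]
  exact LinearIndependent.of_comp toL2.toLinearMap h

/-- Linear independence of the monomials makes the coefficients unique, so two bounds on the
exponents can be combined. -/
lemma mem_trigSupported_inter {s t u : Set (ℤ × ℤ)} {g : TorusFun} (hs : g ∈ trigSupported s)
    (ht : g ∈ trigSupported t) (h : s ∩ t ⊆ u) : g ∈ trigSupported u := by
  rw [trigSupported, Finsupp.mem_span_image_iff_linearCombination] at *
  obtain ⟨c, hc, rfl⟩ := hs
  obtain ⟨d, hd, hcd⟩ := ht
  have : d = c := linearIndependent_torusMonomial hcd
  subst this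
  exact ⟨d, fun k hk => h ⟨hc hk, hd hk⟩, rfl⟩

lemma torusFun_dense {x : Lp ℂ 2 torusMeasure}
    (h : ∀ g : TorusFun, ⟪toL2 g, x⟫_ℂ = 0) : x = 0 := by
  have hd : DenseRange (toL2 : TorusFun → _) :=
    ContinuousMap.toLp_denseRange ℂ torusMeasure ℂ (by norm_num : (2 : ℝ≥0∞) ≠ ⊤)
  exact hd.eq_zero_of_inner_right ℂ h

lemma torusFun_induction {N : Submodule ℂ TorusFun} (hN : IsClosed (N : Set TorusFun))
    (h : ∀ k, torusMonomial k ∈ N) (g : TorusFun) : g ∈ N := by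
  have h1 : (span ℂ (Set.range (mFourier (d := Fin 2)))) ≤ N := by
    rw [span_le]
    rintro _ ⟨k, rfl⟩
    have : ![(k 0, k 1).1, (k 0, k 1).2] = k := by ext i; fin_cases i <;> rfl
    have h2 := h (k 0, k 1)
    rwa [torusMonomial, this] at h2
  have h2 := topologicalClosure_minimal _ h1 hN
  rw [span_mFourier_closure_eq_top] at h2
  exact h2 trivial

end Torus

/-! ### Orthogonality in `L²` weighted by a stable polynomial. -/

section Prediction

open MeasureTheory UnitAddTorus Submodule
open scoped InnerProductSpace ENNReal

/-- The closed subspace of `L²` spanned by the functions `z ^ i * w ^ j * v`, `(i, j) ∈ s`. -/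
noncomputable def weightedSpan (v : TorusFun) (s : Set (ℤ × ℤ)) :
    Submodule ℂ (Lp ℂ 2 torusMeasure) :=
  (span ℂ ((fun k => toL2 (torusMonomial k * v)) '' s)).topologicalClosure

lemma mem_weightedSpan {v : TorusFun} {s : Set (ℤ × ℤ)} {k : ℤ × ℤ} (hk : k ∈ s) :
    toL2 (torusMonomial k * v) ∈ weightedSpan v s :=
  le_topologicalClosure _ (subset_span ⟨k, hk, rfl⟩)

lemma weightedSpan_mono {v : TorusFun} {s t : Set (ℤ × ℤ)} (h : s ⊆ t) :
    weightedSpan v s ≤ weightedSpan v t :=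
  topologicalClosure_mono (span_mono (Set.image_mono h))

lemma mul_mem_weightedSpan {v g : TorusFun} {s : Set (ℤ × ℤ)} (hg : g ∈ trigSupported s) :
    toL2 (g * v) ∈ weightedSpan v s :=
  trigSupported_le (N := (weightedSpan v s).comap
    (toL2.toLinearMap ∘ₗ LinearMap.mulRight ℂ v)) (fun _ hk => mem_weightedSpan hk) hg

lemma inner_eq_zero_of_mem_weightedSpan {v : TorusFun} {s : Set (ℤ × ℤ)}
    {y x : Lp ℂ 2 torusMeasure}
    (h : ∀ k ∈ s, ⟪y, toL2 (torusMonomial k * v)⟫_ℂ = 0) (hx : x ∈ weightedSpan v s) :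
    ⟪y, x⟫_ℂ = 0 := by
  have h1 : span ℂ ((fun k => toL2 (torusMonomial k * v)) '' s) ≤ (ℂ ∙ y)ᗮ := by
    rw [span_le]
    rintro _ ⟨k, hk, rfl⟩
    exact mem_orthogonal_singleton_iff_inner_right.2 (h k hk)
  exact mem_orthogonal_singleton_iff_inner_right.1
    (topologicalClosure_minimal _ h1 (isClosed_orthogonal _) hx)

lemma inner_toL2_mul_eq_zero {c : TorusFun} {s : Set (ℤ × ℤ)} {x : Lp ℂ 2 torusMeasure}
    (h : ∀ k ∈ s, ⟪toL2 (c * torusMonomial k), x⟫_ℂ = 0) {g : TorusFun}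
    (hg : g ∈ trigSupported s) : ⟪toL2 (c * g), x⟫_ℂ = 0 := by
  have := trigSupported_le (N := (ℂ ∙ x)ᗮ.comap
    (toL2.toLinearMap ∘ₗ LinearMap.mulLeft ℂ c)) (fun k hk =>
      mem_orthogonal_singleton_iff_inner_left.2 (h k hk)) hg
  exact mem_orthogonal_singleton_iff_inner_left.1 this

/-- A polynomial `P` of bidegree at most `(n, m)` on the torus together with an inverse `v` that
has Fourier coefficients only at nonnegative frequencies. -/
structure StablePair (n m : ℕ) (P v : TorusFun) : Prop where
  mem : P ∈ trigSupported {k | 0 ≤ k.1 ∧ k.1 ≤ n ∧ 0 ≤ k.2 ∧ k.2 ≤ m}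
  mul_eq_one : P * v = 1
  mean_eq_zero : ∀ k : ℤ × ℤ, 0 < k.1 ∨ 0 < k.2 → torusMean (torusMonomial k * v) = 0

namespace StablePair

variable {n m : ℕ} {P v : TorusFun}

lemma star_mul_eq_one (h : StablePair n m P v) : star P * star v = 1 := by
  simpa only [star_mul', star_one] using congrArg star h.mul_eq_one

lemma reflection_mem (h : StablePair n m P v) : torusMonomial (n, m) * star P ∈
    trigSupported {k | 0 ≤ k.1 ∧ k.1 ≤ n ∧ 0 ≤ k.2 ∧ k.2 ≤ m} := by
  refine mul_mem_trigSupported (torusMonomial_mem (Set.mem_singleton _))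
    (star_mem_trigSupported h.mem (u := {k | -n ≤ k.1 ∧ k.1 ≤ 0 ∧ -m ≤ k.2 ∧ k.2 ≤ 0}) ?_) ?_
  · rintro ⟨i, j⟩ hk
    simp only [Set.mem_ofPred_eq, Prod.fst_neg, Prod.snd_neg] at *
    lia
  · rintro _ rfl ⟨i, j⟩ hk
    simp only [Set.mem_ofPred_eq, Prod.fst_add, Prod.snd_add] at *
    lia

/-- With `R = z^n w^m conj P`, division by `P` splits `conj P * z^i` into `D / P`, `(R / P) a` and
`b`. Each type of term can be tested separately against the weighted space; the bounds on the
exponents of `D` are the point. -/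
lemma exists_decomposition (h : StablePair n m P v) (i : ℤ) :
    ∃ D ∈ trigSupported {k | 0 ≤ k.1 ∧ k.1 < n ∧ k.2 ≤ m},
    ∃ a ∈ trigSupported {k | 0 ≤ k.1}, ∃ b ∈ trigSupported {k | k.1 < 0},
      P * (star P * torusMonomial (i, 0)) = D + torusMonomial (n, m) * star P * a + P * b := by
  have hstar : star P * torusMonomial (i, 0) ∈ trigSupported {k | k.1 ≤ i ∧ k.2 ≤ 0} := by
    refine mul_mem_trigSupported (star_mem_trigSupported h.mem
      (u := {k | k.1 ≤ 0 ∧ k.2 ≤ 0}) ?_) (torusMonomial_mem (Set.mem_singleton _)) ?_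
    · rintro ⟨i, j⟩ hk
      simp only [Set.mem_ofPred_eq, Prod.fst_neg, Prod.snd_neg] at *
      lia
    · rintro ⟨i, j⟩ hk _ rfl
      simp only [Set.mem_ofPred_eq, Prod.fst_add, Prod.snd_add] at *
      lia
  have hP : P * torusMonomial (i - n, -m) ∈ trigSupported {k | k.1 ≤ i ∧ k.2 ≤ 0} := by
    refine mul_mem_trigSupported h.mem (torusMonomial_mem (Set.mem_singleton _)) ?_
    rintro ⟨i, j⟩ hk _ rfl
    simp only [Set.mem_ofPred_eq, Prod.fst_add, Prod.snd_add] at *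
    lia
  obtain ⟨g₁, hg₁, g₂, hg₂, hg⟩ := exists_add_of_mem_trigSupported hstar
    (t := {k | 0 ≤ k.1 ∧ k.2 ≤ 0}) (u := {k | k.1 < 0}) (by
      rintro ⟨i, j⟩ hk
      simp only [Set.mem_ofPred_eq, Set.mem_union] at *
      lia)
  obtain ⟨a₁, ha₁, a₂, ha₂, ha⟩ := exists_add_of_mem_trigSupported hP
    (t := {k | 0 ≤ k.1 ∧ k.2 ≤ 0}) (u := {k | k.1 < 0}) (by
      rintro ⟨i, j⟩ hk
      simp only [Set.mem_ofPred_eq, Set.mem_union] at *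
      lia)
  have hR : torusMonomial (n, m) * star P * (P * torusMonomial (i - n, -m))
      = P * (star P * torusMonomial (i, 0)) := by
    have : torusMonomial (i, 0) = torusMonomial (n, m) * torusMonomial (i - n, -m) := by
      rw [torusMonomial_mul]; simp
    rw [this]; ring
  -- Both sides equal `D`: the left one shows that the exponents of `z` are nonnegative and those of
  -- `w` at most `m`, the right one that those of `z` are below `n`.
  have hD : P * g₁ - torusMonomial (n, m) * star P * a₁
      = torusMonomial (n, m) * star P * a₂ - P * g₂ := by
    rw [← ha, ← hg] at hR
    linear_combination -hR
  refine ⟨P * g₁ - torusMonomial (n, m) * star P * a₁, ?_, a₁,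
    trigSupported_mono (fun k hk => hk.1) ha₁, g₂, hg₂, ?_⟩
  · refine mem_trigSupported_inter (s := {k | 0 ≤ k.1 ∧ k.2 ≤ m}) (t := {k | k.1 < n}) ?_ ?_ ?_
    · refine sub_mem (mul_mem_trigSupported h.mem hg₁ ?_)
        (mul_mem_trigSupported h.reflection_mem ha₁ ?_)
      all_goals
        rintro ⟨i, j⟩ hk ⟨i', j'⟩ hk'
        simp only [Set.mem_ofPred_eq, Prod.fst_add, Prod.snd_add] at *
        lia
    · rw [hD]
      refine sub_mem (mul_mem_trigSupported h.reflection_mem ha₂ ?_)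
        (mul_mem_trigSupported h.mem hg₂ ?_)
      all_goals
        rintro ⟨i, j⟩ hk ⟨i', j'⟩ hk'
        simp only [Set.mem_ofPred_eq, Prod.fst_add] at *
        lia
    · rintro ⟨i, j⟩ hk
      simp only [Set.mem_ofPred_eq, Set.mem_inter_iff] at *
      lia
  · rw [← hg]; ring

lemma inner_torusMonomial_eq_zero (h : StablePair n m P v) {x : Lp ℂ 2 torusMeasure}
    (hx : x ∈ weightedSpan v {k | 0 ≤ k.1 ∧ k.1 < n}) (k : ℤ × ℤ) (hk : k.1 < 0) :
    ⟪toL2 (torusMonomial k), x⟫_ℂ = 0 := by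
  refine inner_eq_zero_of_mem_weightedSpan (fun l hl => ?_) hx
  rw [inner_toL2, star_torusMonomial, ← mul_assoc, torusMonomial_mul]
  refine h.mean_eq_zero _ (Or.inl ?_)
  simp only [Set.mem_ofPred_eq, Prod.fst_add, Prod.fst_neg] at *
  lia

/-- Since `P v = 1`, the product `conj (R v) v` is `conj (z^n w^m v)`, with `R` the reflection of
`P`. The pairing is then the conjugate of the mean of `v` times a monomial of positive degree in
`z`. -/
lemma inner_reflection_eq_zero (h : StablePair n m P v) {x : Lp ℂ 2 torusMeasure}
    (hx : x ∈ weightedSpan v {k | 0 ≤ k.1 ∧ k.1 < n}) (k : ℤ × ℤ) (hk : 0 ≤ k.1) :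
    ⟪toL2 (torusMonomial (n, m) * star P * v * torusMonomial k), x⟫_ℂ = 0 := by
  refine inner_eq_zero_of_mem_weightedSpan (fun l hl => ?_) hx
  have : star (torusMonomial (n, m) * star P * v * torusMonomial k) * (torusMonomial l * v)
      = star (torusMonomial (((n : ℤ), (m : ℤ)) + k - l) * v) := by
    rw [sub_eq_add_neg, ← torusMonomial_mul, ← torusMonomial_mul]
    simp only [star_mul', star_star, star_torusMonomial, neg_neg]
    linear_combination (torusMonomial (-((n : ℤ), (m : ℤ))) * torusMonomial (-k) * star v * torusMonomial l)
      * h.mul_eq_one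
  rw [inner_toL2, this, torusMean_star, h.mean_eq_zero, star_zero]
  left
  simp only [Set.mem_ofPred_eq, Prod.fst_sub, Prod.fst_add] at *
  lia

/-- Pairing with `conj P * z^i w^j` therefore reads off the coefficient of `z^i w^j` in `P x`. -/
lemma inner_star_mul_torusMonomial (h : StablePair n m P v) (k l : ℤ × ℤ) :
    ⟪toL2 (star P * torusMonomial k), toL2 (torusMonomial l * v)⟫_ℂ = if l = k then 1 else 0 := by
  have : star (star P * torusMonomial k) * (torusMonomial l * v) = torusMonomial (l - k) := by
    rw [sub_eq_add_neg, ← torusMonomial_mul, star_mul', star_star, star_torusMonomial]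
    linear_combination (torusMonomial l * torusMonomial (-k)) * h.mul_eq_one
  rw [inner_toL2, this, torusMean_torusMonomial]
  simp [sub_eq_zero]

/-- A vector orthogonal to the functions `z ^ i * w ^ j / P`, `0 ≤ i < n`, `j < m`, and in the span
of those with `0 ≤ i < n`, is `1 / P` times a function without negative powers of `w`. -/
lemma inner_star_mul_eq_zero (h : StablePair n m P v) {x : Lp ℂ 2 torusMeasure}
    (hx : x ∈ weightedSpan v {k | 0 ≤ k.1 ∧ k.1 < n})
    (hx' : ∀ k : ℤ × ℤ, 0 ≤ k.1 → k.1 < n → k.2 < m → ⟪toL2 (torusMonomial k * v), x⟫_ℂ = 0)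
    (k : ℤ × ℤ) (hk : k.2 < 0) :
    ⟪toL2 (star P * torusMonomial k), x⟫_ℂ = 0 := by
  obtain ⟨D, hD, a, ha, b, hb, hE⟩ := h.exists_decomposition k.1
  have e : star P * torusMonomial k = v * (D * torusMonomial (0, k.2))
      + torusMonomial (n, m) * star P * v * (a * torusMonomial (0, k.2))
      + 1 * (b * torusMonomial (0, k.2)) := by
    have : torusMonomial k = torusMonomial (k.1, 0) * torusMonomial (0, k.2) := by
      rw [torusMonomial_mul]; simp
    rw [this]
    linear_combination (v * torusMonomial (0, k.2)) * hE
      + (b * torusMonomial (0, k.2)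
        - star P * torusMonomial (k.1, 0) * torusMonomial (0, k.2)) * h.mul_eq_one
  rw [e, map_add, map_add, inner_add_left, inner_add_left]
  have h1 : ⟪toL2 (v * (D * torusMonomial (0, k.2))), x⟫_ℂ = 0 := by
    refine inner_toL2_mul_eq_zero (s := {k | 0 ≤ k.1 ∧ k.1 < n ∧ k.2 < m}) (fun l hl => ?_)
      (mul_mem_trigSupported hD (torusMonomial_mem (Set.mem_singleton _)) ?_)
    · rw [mul_comm]
      exact hx' l hl.1 hl.2.1 hl.2.2
    · rintro ⟨i, j⟩ hk _ rfl
      simp only [Set.mem_ofPred_eq, Prod.fst_add, Prod.snd_add] at *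
      lia
  have h2 : ⟪toL2 (torusMonomial (n, m) * star P * v * (a * torusMonomial (0, k.2))), x⟫_ℂ = 0 := by
    refine inner_toL2_mul_eq_zero (s := {k | 0 ≤ k.1})
      (fun l hl => h.inner_reflection_eq_zero hx l hl)
      (mul_mem_trigSupported ha (torusMonomial_mem (Set.mem_singleton _)) ?_)
    rintro ⟨i, j⟩ hk _ rfl
    simpa using hk
  have h3 : ⟪toL2 (1 * (b * torusMonomial (0, k.2))), x⟫_ℂ = 0 := by
    refine inner_toL2_mul_eq_zero (s := {k | k.1 < 0})
      (fun l hl => by rw [one_mul]; exact h.inner_torusMonomial_eq_zero hx l hl)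
      (mul_mem_trigSupported hb (torusMonomial_mem (Set.mem_singleton _)) ?_)
    rintro ⟨i, j⟩ hk _ rfl
    simpa using hk
  rw [h1, h2, h3, add_zero, add_zero]

/-- An element of the weighted space is determined by its pairings with `conj P * z ^ i * w ^ j`. -/
lemma eq_sum_of_inner_eq_zero (h : StablePair n m P v) (x : Lp ℂ 2 torusMeasure)
    (s : Finset (ℤ × ℤ)) (hx : ∀ k ∉ s, ⟪toL2 (star P * torusMonomial k), x⟫_ℂ = 0) :
    x = ∑ k ∈ s, ⟪toL2 (star P * torusMonomial k), x⟫_ℂ • toL2 (torusMonomial k * v) := by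
  rw [← sub_eq_zero]
  set d := x - ∑ k ∈ s, ⟪toL2 (star P * torusMonomial k), x⟫_ℂ • toL2 (torusMonomial k * v)
    with hd
  have h1 : ∀ k, ⟪toL2 (star P * torusMonomial k), d⟫_ℂ = 0 := by
    intro k
    rw [hd, inner_sub_right, inner_sum]
    simp only [inner_smul_right, h.inner_star_mul_torusMonomial]
    by_cases hk : k ∈ s
    · simp [hk]
    · simp [hk, hx k hk]
  refine torusFun_dense fun g => ?_
  have h2 : ∀ g, ⟪toL2 (star P * g), d⟫_ℂ = 0 := by
    intro g
    have hc : IsClosed (((ℂ ∙ d)ᗮ.comap (toL2.toLinearMap ∘ₗ LinearMap.mulLeft ℂ (star P)) :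
        Submodule ℂ TorusFun) : Set TorusFun) := by
      refine (isClosed_orthogonal (ℂ ∙ d)).preimage ?_
      exact toL2.continuous.comp (continuous_const.mul continuous_id)
    exact mem_orthogonal_singleton_iff_inner_left.1 (torusFun_induction hc (fun k =>
      mem_orthogonal_singleton_iff_inner_left.2 (h1 k)) g)
  -- `conj P` is invertible, so its multiples include every continuous test function.
  have := h2 (star v * g)
  rwa [← mul_assoc, h.star_mul_eq_one, one_mul] at this

/-- One-sided prediction: orthogonality to the finitely many functions `z ^ i * w ^ j / P`,
`0 ≤ i < n`, `0 ≤ j < m`, implies orthogonality for all `j < m`. -/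
lemma inner_eq_zero_of_lt (h : StablePair n m P v) {G : TorusFun}
    (hG : G ∈ trigSupported {k | 0 ≤ k.1 ∧ k.1 < n ∧ 0 ≤ k.2 ∧ k.2 ≤ m})
    (hGo : ∀ k : ℤ × ℤ, 0 ≤ k.1 → k.1 < n → 0 ≤ k.2 → k.2 < m →
      ⟪toL2 (torusMonomial k * v), toL2 (G * v)⟫_ℂ = 0)
    (k : ℤ × ℤ) (h0 : 0 ≤ k.1) (h1 : k.1 < n) (h2 : k.2 < m) :
    ⟪toL2 (torusMonomial k * v), toL2 (G * v)⟫_ℂ = 0 := by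
  -- The aim is to show that the projection `y` of `F = G / P` to `Y` vanishes. As `F - y` is
  -- orthogonal to `Y`, neither `P (F - y)` nor `G` has negative powers of `w`; so `P y` has
  -- exponents only in the finite box, where `F` is orthogonal by assumption.
  set Y := weightedSpan v {k | 0 ≤ k.1 ∧ k.1 < n ∧ k.2 < m} with hY
  have hYc : IsClosed (Y : Set (Lp ℂ 2 torusMeasure)) := isClosed_topologicalClosure _
  have : CompleteSpace Y := hYc.completeSpace_coe
  set F := toL2 (G * v) with hF
  have hFs : F ∈ weightedSpan v {k | 0 ≤ k.1 ∧ k.1 < n} :=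
    weightedSpan_mono (fun _ hk => And.intro hk.1 hk.2.1) (mul_mem_weightedSpan hG)
  set y : Lp ℂ 2 torusMeasure := Y.starProjection F with hy
  have hyY : y ∈ Y := starProjection_apply_mem Y F
  have hys : y ∈ weightedSpan v {k | 0 ≤ k.1 ∧ k.1 < n} :=
    weightedSpan_mono (fun _ hk => And.intro hk.1 hk.2.1) hyY
  have hu : ∀ x ∈ Y, ⟪x, F - y⟫_ℂ = 0 := fun x hx =>
    (mem_orthogonal _ _).1 (sub_starProjection_mem_orthogonal F) x hx
  have hbox : ∀ k ∉ Finset.Ico (0 : ℤ) n ×ˢ Finset.Ico (0 : ℤ) m,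
      ⟪toL2 (star P * torusMonomial k), y⟫_ℂ = 0 := by
    intro k hk
    by_cases hc : 0 ≤ k.1 ∧ k.1 < n ∧ k.2 < m
    · have hneg : k.2 < 0 := by
        by_contra hcon
        exact hk (by simp; lia)
      have e1 := h.inner_star_mul_eq_zero (sub_mem hFs hys)
        (fun l h1 h2 h3 => hu _ (mem_weightedSpan ⟨h1, h2, h3⟩)) k hneg
      have e2 : ⟪toL2 (star P * torusMonomial k), F⟫_ℂ = 0 := by
        refine inner_eq_zero_of_mem_weightedSpan (fun l hl => ?_) (mul_mem_weightedSpan hG)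
        rw [h.inner_star_mul_torusMonomial, if_neg]
        rintro rfl
        simp only [Set.mem_ofPred_eq] at hl
        lia
      rwa [inner_sub_right, e2, zero_sub, neg_eq_zero] at e1
    · refine inner_eq_zero_of_mem_weightedSpan (fun l hl => ?_) hyY
      rw [h.inner_star_mul_torusMonomial, if_neg]
      rintro rfl
      exact hc hl
  have hsum := h.eq_sum_of_inner_eq_zero y _ hbox
  have hyF : ⟪y, F⟫_ℂ = 0 := by
    rw [hsum, sum_inner]
    refine Finset.sum_eq_zero fun k hk => ?_
    simp only [Finset.mem_product, Finset.mem_Ico] at hk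
    rw [inner_smul_left, hGo k hk.1.1 hk.1.2 hk.2.1 hk.2.2, mul_zero]
  have hyy : ⟪y, y⟫_ℂ = 0 := by
    have := hu y hyY
    rw [inner_sub_right, hyF, zero_sub, neg_eq_zero] at this
    exact this
  have hy0 : y = 0 := inner_self_eq_zero.1 hyy
  have := hu _ (mem_weightedSpan (v := v) (k := k) ⟨h0, h1, h2⟩)
  rwa [hy0, sub_zero] at this

/-- Orthogonality to the functions of bidegree at most `(n - 1, m - 1)` implies orthogonality to
those of bidegree at most `(n, m - 1)`. -/
theorem inner_eq_zero_of_le (h : StablePair n m P v) {P₀ v₀ : TorusFun}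
    (hP : P - P₀ ∈ trigSupported {k | 1 ≤ k.1 ∧ k.1 ≤ n ∧ 0 ≤ k.2 ∧ k.2 ≤ m})
    (hv₀ : v₀ ∈ (trigSupported {k | k.1 = 0 ∧ 0 ≤ k.2}).topologicalClosure)
    (hPv₀ : P₀ * v₀ = 1) {G : TorusFun}
    (hG : G ∈ trigSupported {k | 0 ≤ k.1 ∧ k.1 < n ∧ 0 ≤ k.2 ∧ k.2 ≤ m})
    (hGo : ∀ k : ℤ × ℤ, 0 ≤ k.1 → k.1 < n → 0 ≤ k.2 → k.2 < m →
      ⟪toL2 (torusMonomial k * v), toL2 (G * v)⟫_ℂ = 0)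
    (k : ℤ × ℤ) (h0 : 0 ≤ k.1) (h1 : k.1 ≤ n) (h2 : k.2 < m) :
    ⟪toL2 (torusMonomial k * v), toL2 (G * v)⟫_ℂ = 0 := by
  rcases lt_or_eq_of_le h1 with h1 | h1
  · exact h.inner_eq_zero_of_lt hG hGo k h0 h1 h2
  obtain ⟨i, j⟩ := k
  simp only at h0 h1 h2
  subst h1
  have hFs : toL2 (G * v) ∈ weightedSpan v {k | 0 ≤ k.1 ∧ k.1 < n} :=
    weightedSpan_mono (fun _ hk => And.intro hk.1 hk.2.1) (mul_mem_weightedSpan hG)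
  -- Only the column `z^n` remains. Taking `g = v₀` will cancel `conj P₀`; by continuity it suffices
  -- to treat polynomials `g` in `w`.
  have key : ∀ g ∈ (trigSupported {k | k.1 = 0 ∧ 0 ≤ k.2}).topologicalClosure,
      ⟪toL2 (star P₀ * torusMonomial (n, j) * star g * v), toL2 (G * v)⟫_ℂ = 0 := by
    intro g hg
    set T : TorusFun → ℂ := fun g =>
      ⟪toL2 (G * v), toL2 (star P₀ * torusMonomial (n, j) * star g * v)⟫_ℂ
    have hTc : Continuous T := by
      have : Continuous fun g : TorusFun => star P₀ * torusMonomial (n, j) * star g * v := by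
        fun_prop
      exact continuous_const.inner (toL2.continuous.comp this)
    have hcl : IsClosed {g | T g = 0} := isClosed_eq hTc continuous_const
    have hsub : ((trigSupported {k | k.1 = 0 ∧ 0 ≤ k.2} : Submodule ℂ TorusFun) : Set TorusFun)
        ⊆ {g | T g = 0} := by
      intro g hg
      -- Replacing `P₀` by `P` produces the reflection of `P`, which is harmless. The correction by
      -- `P - P₀` has only positive powers of `z`, so its conjugate moves the column `n` into the
      -- columns below `n`, already settled.
      have e : star P₀ * torusMonomial (n, j) * star g * v
          = torusMonomial (n, m) * star P * v * (torusMonomial (0, j - m) * star g)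
            - v * (torusMonomial (n, j) * star (P - P₀) * star g) := by
        have : torusMonomial (n, j) = torusMonomial (n, m) * torusMonomial (0, j - m) := by
          rw [torusMonomial_mul]; simp
        rw [this, star_sub]; ring
      refine inner_eq_zero_symm.1 ?_
      rw [e, map_sub, inner_sub_left]
      have hg' : star g ∈ trigSupported {k | k.1 = 0 ∧ k.2 ≤ 0} :=
        star_mem_trigSupported hg (by
          rintro ⟨i, j⟩ hk
          simp only [Set.mem_ofPred_eq, Prod.fst_neg, Prod.snd_neg] at *
          lia)
      rw [inner_toL2_mul_eq_zero (s := {k | 0 ≤ k.1})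
        (fun l hl => h.inner_reflection_eq_zero hFs l hl), zero_sub, neg_eq_zero]
      · refine inner_toL2_mul_eq_zero (s := {k | 0 ≤ k.1 ∧ k.1 < n ∧ k.2 < m})
          (fun l hl => by
            rw [mul_comm]; exact h.inner_eq_zero_of_lt hG hGo l hl.1 hl.2.1 hl.2.2) ?_
        refine mul_mem_trigSupported (mul_mem_trigSupported
          (torusMonomial_mem (Set.mem_singleton _)) (star_mem_trigSupported hP
          (u := {k | -n ≤ k.1 ∧ k.1 ≤ -1 ∧ k.2 ≤ 0}) ?_)
          (u := {k | 0 ≤ k.1 ∧ k.1 < n ∧ k.2 < m}) ?_) hg' ?_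
        · rintro ⟨i, j⟩ hk
          simp only [Set.mem_ofPred_eq, Prod.fst_neg, Prod.snd_neg] at *
          lia
        · rintro _ rfl ⟨i, j⟩ hk
          simp only [Set.mem_ofPred_eq, Prod.fst_add, Prod.snd_add] at *
          lia
        · rintro ⟨i, j⟩ hk ⟨i', j'⟩ hk'
          simp only [Set.mem_ofPred_eq, Prod.fst_add, Prod.snd_add] at *
          lia
      · refine mul_mem_trigSupported (torusMonomial_mem (Set.mem_singleton _)) hg' ?_
        rintro _ rfl ⟨i, j⟩ hk
        simp only [Set.mem_ofPred_eq, Prod.fst_add] at *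
        lia
    exact inner_eq_zero_symm.1 (closure_minimal hsub hcl hg)
  have := key v₀ hv₀
  have e : star P₀ * torusMonomial (n, j) * star v₀ * v = torusMonomial (n, j) * v := by
    have : star P₀ * star v₀ = 1 := by simpa only [star_mul', star_one] using congrArg star hPv₀
    linear_combination (torusMonomial (n, j) * v) * this
  rwa [e] at this

end StablePair

end Prediction

/-! ### Polynomials on the torus and inverses of stable polynomials. -/

section TorusEval

open Submodule
open scoped InnerProductSpace

/-- Gelfand theory: a nonunit is killed by a character `χ`, and `(χ (x 0), χ (x 1))` would be a zero
of `p` in the closed bidisk. -/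
lemma isUnit_aeval_of_norm_le_one {A : Type*} [NormedCommRing A] [NormedAlgebra ℂ A]
    [CompleteSpace A] [NormOneClass A] (x : Fin 2 → A) (hx : ∀ i, ‖x i‖ ≤ 1)
    (p : Poly2) (hp : ∀ z w : ℂ, ‖z‖ ≤ 1 → ‖w‖ ≤ 1 → ev p z w ≠ 0) : IsUnit (aeval x p) := by
  by_contra hu
  obtain ⟨χ, hχ⟩ := WeakDual.CharacterSpace.exists_apply_eq_zero hu
  have hχn (i : Fin 2) : ‖χ (x i)‖ ≤ 1 :=
    (spectrum.norm_le_norm_of_mem (AlgHom.apply_mem_spectrum χ (x i))).trans (hx i)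
  refine hp (χ (x 0)) (χ (x 1)) (hχn 0) (hχn 1) ?_
  have h := comp_aeval_apply (f := x) (WeakDual.CharacterSpace.toAlgHom χ) p
  rw [← hχ, ev, ← coe_aeval_eq_eval]
  refine Eq.trans ?_ h.symm
  have : ![χ (x 0), χ (x 1)] = fun i => WeakDual.CharacterSpace.toAlgHom χ (x i) := by
    ext i
    fin_cases i <;> rfl
  rw [this]
  rfl

/-- A polynomial without zeros on the closed bidisk is invertible in the closed algebra generated
by two contractions. -/
lemma exists_mem_topologicalClosure_mul_eq_one (x : Fin 2 → TorusFun) (hx : ∀ i, ‖x i‖ ≤ 1)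
    (p : Poly2) (hp : ∀ z w : ℂ, ‖z‖ ≤ 1 → ‖w‖ ≤ 1 → ev p z w ≠ 0) :
    ∃ v ∈ (aeval x : Poly2 →ₐ[ℂ] TorusFun).range.topologicalClosure, aeval x p * v = 1 := by
  set A := (aeval x : Poly2 →ₐ[ℂ] TorusFun).range.topologicalClosure with hA
  have hAc : IsClosed (A : Set TorusFun) := Subalgebra.isClosed_topologicalClosure _
  have : CompleteSpace A := hAc.completeSpace_coe
  have : NormOneClass A := ⟨(norm_one : ‖(1 : TorusFun)‖ = 1)⟩
  have hmem (f : Poly2) : aeval x f ∈ A := Subalgebra.le_topologicalClosure _ ⟨f, rfl⟩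
  let y : Fin 2 → A := fun i => ⟨x i, by simpa using hmem (X i)⟩
  have hy (f : Poly2) : A.val (aeval y f) = aeval x f := comp_aeval_apply (f := y) A.val f
  -- Inverting inside the closed subalgebra, not in `TorusFun`, makes the inverse a uniform limit of
  -- polynomials, hence analytic.
  obtain ⟨u, hu⟩ := (isUnit_aeval_of_norm_le_one y hx p hp).exists_right_inv
  refine ⟨A.val u, u.2, ?_⟩
  rw [← hy, ← map_mul]
  exact congrArg A.val hu

/-- The restriction of a polynomial to the torus. -/
noncomputable def torusEval : Poly2 →ₐ[ℂ] TorusFun :=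
  aeval ![torusMonomial (1, 0), torusMonomial (0, 1)]

lemma torusEval_apply (f : Poly2) (x : UnitAddTorus (Fin 2)) :
    torusEval f x = ev f (torusMonomial (1, 0) x) (torusMonomial (0, 1) x) := by
  induction f using MvPolynomial.induction_on with
  | C a => simp [torusEval, ev, _root_.algebraMap_apply]
  | add p q hp hq => rw [map_add, ContinuousMap.add_apply, hp, hq, ev, ev, ev, map_add]
  | mul_X p i hp =>
    rw [map_mul, ContinuousMap.mul_apply, hp, ev, ev, map_mul]
    congr 1
    fin_cases i <;> simp [torusEval]

lemma torusMonomial_pow (k : ℤ × ℤ) (j : ℕ) : torusMonomial k ^ j = torusMonomial (j • k) := by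
  induction j with
  | zero => simp
  | succ j ih => rw [pow_succ, ih, torusMonomial_mul, succ_nsmul]

/-- The exponent of a monomial as a pair of integers. -/
def expPair (k : Fin 2 →₀ ℕ) : ℤ × ℤ := (k 0, k 1)

lemma expPair_injective : Function.Injective expPair := by
  intro k l h
  simp only [expPair, Prod.mk.injEq, Nat.cast_inj] at h
  ext i
  fin_cases i
  exacts [h.1, h.2]

lemma torusEval_monomial (k : Fin 2 →₀ ℕ) : torusEval (monomial k 1) = torusMonomial (expPair k) := by
  rw [torusEval, aeval_monomial, Finsupp.prod_fintype _ _ (by simp), Fin.prod_univ_two]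
  simp [torusMonomial_pow, torusMonomial_mul, expPair]

lemma mem_of_monomial_mem {N : Submodule ℂ Poly2} (h : ∀ k, monomial k 1 ∈ N) (f : Poly2) :
    f ∈ N := by
  have : (⊤ : Submodule ℂ Poly2) ≤ N := by
    rw [← (basisMonomials (Fin 2) ℂ).span_eq, span_le]
    rintro _ ⟨k, rfl⟩
    simpa using h k
  exact this trivial

/-- Polynomials of degree less than `a` in `z` and less than `b` in `w`. -/
noncomputable def degreeLtLt (a b : ℕ) : Submodule ℂ Poly2 :=
  restrictSupport ℂ {k | k 0 < a ∧ k 1 < b}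

lemma monomial_mem_degreeLtLt {a b : ℕ} {k : Fin 2 →₀ ℕ} (h0 : k 0 < a) (h1 : k 1 < b) :
    (monomial k 1 : Poly2) ∈ degreeLtLt a b :=
  (monomial_mem_restrictSupport ℂ).2 (Or.inl ⟨h0, h1⟩)

lemma degreeLtLt_le {a b : ℕ} {N : Submodule ℂ Poly2}
    (h : ∀ k : Fin 2 →₀ ℕ, k 0 < a → k 1 < b → monomial k 1 ∈ N) : degreeLtLt a b ≤ N := by
  rw [degreeLtLt, restrictSupport_eq_span, span_le]
  rintro _ ⟨k, hk, rfl⟩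
  exact h k hk.1 hk.2

lemma degreeLtLt_mono {a b c d : ℕ} (h : a ≤ c) (h' : b ≤ d) :
    degreeLtLt a b ≤ degreeLtLt c d :=
  restrictSupport_mono _ fun _ hk => ⟨hk.1.trans_le h, hk.2.trans_le h'⟩

lemma mem_degreeLtLt {a b : ℕ} {f : Poly2} (hf : ∀ k ∈ f.support, k 0 < a ∧ k 1 < b) :
    f ∈ degreeLtLt a b := hf

lemma torusEval_mem {a b : ℕ} {s : Set (ℤ × ℤ)} {f : Poly2} (hf : f ∈ degreeLtLt a b)
    (h : ∀ k : Fin 2 →₀ ℕ, k 0 < a → k 1 < b → expPair k ∈ s) : torusEval f ∈ trigSupported s :=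
  degreeLtLt_le (N := (trigSupported s).comap torusEval.toLinearMap) (fun k h0 h1 => by
    rw [mem_comap, AlgHom.toLinearMap_apply, torusEval_monomial]
    exact torusMonomial_mem (h k h0 h1)) hf

lemma torusMean_mul_torusEval (k : Fin 2 →₀ ℕ) (f : Poly2) :
    torusMean (torusMonomial (-expPair k) * torusEval f) = coeff k f := by
  have := mem_of_monomial_mem (N := LinearMap.eqLocus (torusMean.toLinearMap ∘ₗ
    LinearMap.mulLeft ℂ (torusMonomial (-expPair k)) ∘ₗ torusEval.toLinearMap) (lcoeff ℂ k))
    (fun l => by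
      simp [torusEval_monomial, torusMonomial_mul, torusMean_torusMonomial,
        neg_add_eq_zero, expPair_injective.eq_iff, eq_comm]) f
  exact this

/-- The exponents of degree less than `a` in `z` and less than `b` in `w`. -/
noncomputable def exponentEquiv (a b : ℕ) : {k : Fin 2 →₀ ℕ | k 0 < a ∧ k 1 < b} ≃ Fin a × Fin b where
  toFun k := (⟨k.1 0, k.2.1⟩, ⟨k.1 1, k.2.2⟩)
  invFun ij := ⟨Finsupp.equivFunOnFinite.symm ![ij.1, ij.2], by simp⟩
  left_inv k := by ext i; fin_cases i <;> simp
  right_inv ij := by simp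

instance finiteDimensional_degreeLtLt (a b : ℕ) : FiniteDimensional ℂ (degreeLtLt a b) :=
  have := Finite.of_equiv _ (exponentEquiv a b).symm
  Module.Basis.finiteDimensional_of_finite (basisRestrictSupport ℂ _)

lemma finrank_degreeLtLt (a b : ℕ) : Module.finrank ℂ (degreeLtLt a b) = a * b := by
  have := Fintype.ofEquiv _ (exponentEquiv a b).symm
  rw [degreeLtLt, Module.finrank_eq_card_basis (basisRestrictSupport ℂ _),
    Fintype.card_congr (exponentEquiv a b)]
  simp

end TorusEval

/-! ### Polynomials with the weight `1 / |p|²`. -/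

section ChristoffelDarboux

open Submodule
open scoped InnerProductSpace

lemma norm_toL2_torusMonomial_mul (k : ℤ × ℤ) (g : TorusFun) :
    ‖toL2 (torusMonomial k * g)‖ = ‖toL2 g‖ := by
  have : ⟪toL2 (torusMonomial k * g), toL2 (torusMonomial k * g)⟫_ℂ = ⟪toL2 g, toL2 g⟫_ℂ := by
    have h1 : star (torusMonomial k) * torusMonomial k = 1 := by
      rw [star_torusMonomial, torusMonomial_mul, neg_add_cancel, torusMonomial_zero]
    rw [inner_toL2, inner_toL2, star_mul']
    congr 1
    linear_combination (star g * g) * h1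
  rw [inner_self_eq_norm_sq_to_K, inner_self_eq_norm_sq_to_K] at this
  have h2 : ‖toL2 (torusMonomial k * g)‖ ^ 2 = ‖toL2 g‖ ^ 2 := by exact_mod_cast this
  exact (sq_eq_sq₀ (norm_nonneg _) (norm_nonneg _)).1 h2

lemma mean_eq_zero_of_mem_closure {v : TorusFun}
    (hv : v ∈ (torusEval.range.topologicalClosure : Subalgebra ℂ TorusFun)) (k : ℤ × ℤ)
    (hk : 0 < k.1 ∨ 0 < k.2) : torusMean (torusMonomial k * v) = 0 := by
  have hcl : IsClosed {g : TorusFun | torusMean (torusMonomial k * g) = 0} :=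
    isClosed_eq (torusMean.continuous.comp (continuous_const.mul continuous_id)) continuous_const
  refine closure_minimal ?_ hcl hv
  rintro _ ⟨f, rfl⟩
  refine mem_of_monomial_mem (N := LinearMap.ker (torusMean.toLinearMap ∘ₗ
    LinearMap.mulLeft ℂ (torusMonomial k) ∘ₗ torusEval.toLinearMap)) (fun l => ?_) f
  have : k + expPair l ≠ 0 := by
    intro h
    have h1 := congrArg Prod.fst h
    have h2 := congrArg Prod.snd h
    simp only [expPair, Prod.fst_add, Prod.snd_add, Prod.fst_zero, Prod.snd_zero] at h1 h2
    lia
  simp [torusEval_monomial, torusMonomial_mul, torusMean_torusMonomial, this]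

variable {n m : ℕ} {p r : Poly2} {v : TorusFun}

lemma stablePair_torusEval (hp : p ∈ degreeLtLt (n + 1) (m + 1))
    (hv : v ∈ (torusEval.range.topologicalClosure : Subalgebra ℂ TorusFun))
    (h1 : torusEval p * v = 1) : StablePair n m (torusEval p) v where
  mem := torusEval_mem hp fun k h0 h1 => by
    simp only [expPair, Set.mem_ofPred_eq]
    lia
  mul_eq_one := h1
  mean_eq_zero := mean_eq_zero_of_mem_closure hv

/-- The restriction `p(0, w)` of a stable polynomial to the torus is invertible, with inverse
analytic in `w`. -/
lemma exists_section (hp : p ∈ degreeLtLt (n + 1) (m + 1))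
    (hstable : ∀ z w : ℂ, ‖z‖ ≤ 1 → ‖w‖ ≤ 1 → ev p z w ≠ 0) :
    ∃ P₀ v₀ : TorusFun,
      torusEval p - P₀ ∈ trigSupported {k | 1 ≤ k.1 ∧ k.1 ≤ n ∧ 0 ≤ k.2 ∧ k.2 ≤ m} ∧
      v₀ ∈ (trigSupported {k | k.1 = 0 ∧ 0 ≤ k.2}).topologicalClosure ∧ P₀ * v₀ = 1 := by
  -- Substituting the contraction `0` for `z` yields `p(0, w)` and its inverse by the same Gelfand
  -- argument.
  set x : Fin 2 → TorusFun := ![0, torusMonomial (0, 1)] with hx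
  have hmon (k : Fin 2 →₀ ℕ) : aeval x (monomial k (1 : ℂ))
      = if k 0 = 0 then torusMonomial (expPair k) else 0 := by
    rw [aeval_monomial, Finsupp.prod_fintype _ _ (by simp), Fin.prod_univ_two]
    split_ifs with h <;> simp [hx, h, torusMonomial_pow, expPair]
  obtain ⟨v₀, hv₀, h1⟩ := exists_mem_topologicalClosure_mul_eq_one x (fun i => by
    fin_cases i
    · simp [hx]
    · simp [hx, norm_torusMonomial]) p hstable
  refine ⟨aeval x p, v₀, ?_, ?_, h1⟩
  · refine degreeLtLt_le (N := (trigSupported _).comap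
      (torusEval.toLinearMap - (aeval x : Poly2 →ₐ[ℂ] TorusFun).toLinearMap)) (fun k h0 h1 => ?_) hp
    rw [mem_comap, LinearMap.sub_apply, AlgHom.toLinearMap_apply, AlgHom.toLinearMap_apply, hmon,
      torusEval_monomial]
    split_ifs with h
    · simp
    · rw [sub_zero]
      refine torusMonomial_mem ?_
      simp only [expPair, Set.mem_ofPred_eq]
      lia
  · refine closure_mono ?_ hv₀
    rintro _ ⟨f, rfl⟩
    refine mem_of_monomial_mem (N := (trigSupported _).comap
      (aeval x : Poly2 →ₐ[ℂ] TorusFun).toLinearMap) (fun k => ?_) f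
    rw [mem_comap, AlgHom.toLinearMap_apply, hmon]
    split_ifs with h
    · refine torusMonomial_mem ?_
      simp [expPair, h]
    · exact zero_mem _

/-- The polynomial `f` divided by the stable polynomial, as an element of `L²`. -/
noncomputable def weightedMap (v : TorusFun) :
    Poly2 →ₗ[ℂ] MeasureTheory.Lp ℂ 2 torusMeasure :=
  toL2.toLinearMap ∘ₗ LinearMap.mulRight ℂ v ∘ₗ torusEval.toLinearMap

lemma weightedMap_apply (v : TorusFun) (f : Poly2) : weightedMap v f = toL2 (torusEval f * v) := rfl

lemma weightedMap_injective (h : StablePair n m (torusEval p) v) :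
    Function.Injective (weightedMap v) := by
  rw [injective_iff_map_eq_zero]
  intro f hf
  ext k
  have : ⟪toL2 (star (torusEval p) * torusMonomial (expPair k)), weightedMap v f⟫_ℂ
      = coeff k f := by
    rw [weightedMap_apply, inner_toL2, ← torusMean_mul_torusEval, star_mul', star_star,
      star_torusMonomial]
    congr 1
    linear_combination (torusMonomial (-expPair k) * torusEval f) * h.mul_eq_one
  rw [← this, hf, inner_zero_right, coeff_zero]

lemma norm_weightedMap_X_mul (v : TorusFun) (i : Fin 2) (f : Poly2) :
    ‖weightedMap v (X i * f)‖ = ‖weightedMap v f‖ := by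
  rw [weightedMap_apply, weightedMap_apply, map_mul torusEval, mul_assoc, X, torusEval_monomial,
    norm_toL2_torusMonomial_mul]

lemma inner_weightedMap_eq_zero {x : MeasureTheory.Lp ℂ 2 torusMeasure} {s : Set (ℤ × ℤ)}
    (h : ∀ k ∈ s, ⟪toL2 (torusMonomial k * v), x⟫_ℂ = 0) {g : Poly2}
    (hg : torusEval g ∈ trigSupported s) : ⟪weightedMap v g, x⟫_ℂ = 0 := by
  rw [weightedMap_apply, mul_comm]
  exact inner_toL2_mul_eq_zero (fun k hk => by rw [mul_comm]; exact h k hk) hg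

lemma weightedMap_orthogonal (h : StablePair n m (torusEval p) v)
    (hp : p ∈ degreeLtLt (n + 1) (m + 1))
    (hstable : ∀ z w : ℂ, ‖z‖ ≤ 1 → ‖w‖ ≤ 1 → ev p z w ≠ 0) {f : Poly2}
    (hf : f ∈ degreeLtLt n (m + 1))
    (hfo : ∀ g ∈ degreeLtLt n m, ⟪weightedMap v g, weightedMap v f⟫_ℂ = 0)
    {g : Poly2} (hg : g ∈ degreeLtLt (n + 1) m) : ⟪weightedMap v g, weightedMap v f⟫_ℂ = 0 := by
  obtain ⟨P₀, v₀, h1, h2, h3⟩ := exists_section hp hstable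
  refine inner_weightedMap_eq_zero (s := {k | 0 ≤ k.1 ∧ k.1 ≤ n ∧ 0 ≤ k.2 ∧ k.2 < m})
    (fun k hk => ?_) (torusEval_mem hg fun k h0 h1 => ?_)
  · refine h.inner_eq_zero_of_le h1 h2 h3 (torusEval_mem hf fun k h0 h1 => ?_) (fun k a b c d => ?_)
      k hk.1 hk.2.1 hk.2.2.2
    · simp only [expPair, Set.mem_ofPred_eq]
      lia
    · obtain ⟨i, j⟩ := k
      lift i to ℕ using a
      lift j to ℕ using c
      have := hfo _ (monomial_mem_degreeLtLt (k := Finsupp.equivFunOnFinite.symm ![i, j])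
        (by simpa using b) (by simpa using d))
      rw [weightedMap_apply, torusEval_monomial] at this
      simpa [expPair, weightedMap_apply] using this
  · simp only [expPair, Set.mem_ofPred_eq]
    lia

/-- The antiunitary map `f / p ↦ z^n w^m conj f / p` sends exponents `k` to `(n, m) - k`. It carries
this configuration back to the one in `StablePair.inner_eq_zero_of_le`. -/
lemma weightedMap_orthogonal_reflected (h : StablePair n m (torusEval p) v)
    (hp : p ∈ degreeLtLt (n + 1) (m + 1))
    (hstable : ∀ z w : ℂ, ‖z‖ ≤ 1 → ‖w‖ ≤ 1 → ev p z w ≠ 0) {f : Poly2}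
    (hf : f ∈ degreeLtLt n (m + 1))
    (hfo : ∀ g ∈ degreeLtLt n m,
      ⟪weightedMap v (X 0 * (X 1 * g)), weightedMap v (X 0 * f)⟫_ℂ = 0)
    {g : Poly2} (hg : g ∈ degreeLtLt (n + 1) m) :
    ⟪weightedMap v (X 1 * g), weightedMap v (X 0 * f)⟫_ℂ = 0 := by
  obtain ⟨P₀, v₀, h1, h2, h3⟩ := exists_section hp hstable
  have e0 : torusEval (X 0) = torusMonomial (1, 0) := by simp [torusEval]
  have e1 : torusEval (X 1) = torusMonomial (0, 1) := by simp [torusEval]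
  set G : TorusFun := torusMonomial (n, m) * star (torusEval (X 0 * f)) with hG
  have hGm : G ∈ trigSupported {k | 0 ≤ k.1 ∧ k.1 < n ∧ 0 ≤ k.2 ∧ k.2 ≤ m} := by
    have hf' : torusEval (X 0 * f) ∈ trigSupported {k | 0 < k.1 ∧ k.1 ≤ n ∧ 0 ≤ k.2 ∧ k.2 ≤ m} := by
      rw [map_mul, e0]
      refine mul_mem_trigSupported (torusMonomial_mem (Set.mem_singleton _))
        (torusEval_mem hf (s := {k | 0 ≤ k.1 ∧ k.1 < n ∧ 0 ≤ k.2 ∧ k.2 ≤ m}) fun k h0 h1 => ?_) ?_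
      · simp only [expPair, Set.mem_ofPred_eq]
        lia
      · rintro _ rfl ⟨i, j⟩ hk
        simp only [Set.mem_ofPred_eq, Prod.fst_add, Prod.snd_add] at *
        lia
    refine mul_mem_trigSupported (torusMonomial_mem (Set.mem_singleton _))
      (star_mem_trigSupported hf' (u := {k | -n ≤ k.1 ∧ k.1 < 0 ∧ -m ≤ k.2 ∧ k.2 ≤ 0}) ?_) ?_
    · rintro ⟨i, j⟩ hk
      simp only [Set.mem_ofPred_eq, Prod.fst_neg, Prod.snd_neg] at *
      lia
    · rintro _ rfl ⟨i, j⟩ hk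
      simp only [Set.mem_ofPred_eq, Prod.fst_add, Prod.snd_add] at *
      lia
  have hinner (k : ℤ × ℤ) : ⟪toL2 (torusMonomial k * v), toL2 (G * v)⟫_ℂ
      = star ⟪toL2 (torusMonomial (((n : ℤ), (m : ℤ)) - k) * v), weightedMap v (X 0 * f)⟫_ℂ := by
    rw [weightedMap_apply, inner_toL2, inner_toL2, ← torusMean_star, hG, sub_eq_add_neg,
      ← torusMonomial_mul]
    simp only [star_mul', star_star, star_torusMonomial, neg_neg]
    congr 1
    ring
  refine inner_weightedMap_eq_zero (s := {k | 0 ≤ k.1 ∧ k.1 ≤ n ∧ 1 ≤ k.2 ∧ k.2 ≤ m})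
    (fun k hk => ?_) ?_
  · have := h.inner_eq_zero_of_le h1 h2 h3 hGm (fun k a b c d => ?_) (((n : ℤ), (m : ℤ)) - k)
      (by simpa using hk.2.1) (by simpa using hk.1) (by have := hk.2.2.1; simp; lia)
    · rw [hinner, star_eq_zero, sub_sub_cancel] at this
      exact this
    · obtain ⟨i, j⟩ := k
      simp only at a b c d
      obtain ⟨i', hi'⟩ : ∃ i' : ℕ, (i' : ℤ) = n - 1 - i := ⟨(n - 1 - i).toNat, by lia⟩
      obtain ⟨j', hj'⟩ : ∃ j' : ℕ, (j' : ℤ) = m - 1 - j := ⟨(m - 1 - j).toNat, by lia⟩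
      have := hfo _ (monomial_mem_degreeLtLt (k := Finsupp.equivFunOnFinite.symm ![i', j'])
        (by simp; lia) (by simp; lia))
      rw [weightedMap_apply, map_mul torusEval, map_mul torusEval, torusEval_monomial, e0, e1, torusMonomial_mul,
        torusMonomial_mul] at this
      rw [hinner, star_eq_zero]
      convert this using 4
      congr 1
      ext <;> simp [expPair] <;> lia
  · rw [map_mul, e1]
    refine mul_mem_trigSupported (torusMonomial_mem (Set.mem_singleton _))
      (torusEval_mem hg (s := {k | 0 ≤ k.1 ∧ k.1 ≤ n ∧ 0 ≤ k.2 ∧ k.2 < m}) fun k h0 h1 => ?_) ?_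
    · simp only [expPair, Set.mem_ofPred_eq]
      lia
    · rintro _ rfl ⟨i, j⟩ hk
      simp only [Set.mem_ofPred_eq, Prod.fst_add, Prod.snd_add] at *
      lia

end ChristoffelDarboux

/-! ### The Christoffel–Darboux formula. -/

section ChristoffelDarbouxFormula

open Submodule
open scoped InnerProductSpace

variable {n m : ℕ} {p r : Poly2} {v : TorusFun}

lemma torusEval_eq_of_reflection
    (hr : ∀ z w : ℂ, ‖z‖ = 1 → ‖w‖ = 1 → ev r z w = z ^ n * w ^ m * star (ev p z w)) :
    torusEval r = torusMonomial (n, m) * star (torusEval p) := by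
  have hnorm (k : ℤ × ℤ) (x) : ‖torusMonomial k x‖ = 1 := by
    have h1 : star (torusMonomial k) * torusMonomial k = 1 := by
      rw [star_torusMonomial, torusMonomial_mul, neg_add_cancel, torusMonomial_zero]
    have h2 : star (torusMonomial k x) * torusMonomial k x = 1 := congrArg (fun g => g x) h1
    have h3 := congrArg norm h2
    rw [norm_mul, norm_star, norm_one] at h3
    nlinarith [norm_nonneg (torusMonomial k x)]
  have e : torusMonomial ((n : ℤ), (m : ℤ)) = torusMonomial (1, 0) ^ n * torusMonomial (0, 1) ^ m := by
    rw [torusMonomial_pow, torusMonomial_pow, torusMonomial_mul]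
    simp
  ext x
  rw [torusEval_apply, hr _ _ (hnorm _ x) (hnorm _ x), e]
  simp [torusEval_apply]

lemma norm_eq_one_of_inner_self {x : MeasureTheory.Lp ℂ 2 torusMeasure} (h : ⟪x, x⟫_ℂ = 1) :
    ‖x‖ = 1 := by
  rw [inner_self_eq_norm_sq_to_K] at h
  have h2 : ((‖x‖ ^ 2 : ℝ) : ℂ) = 1 := by simpa using h
  have h3 : ‖x‖ ^ 2 = 1 := by exact_mod_cast h2
  exact (pow_eq_one_iff_of_nonneg (norm_nonneg x) two_ne_zero).1 h3

lemma norm_weightedMap_self (h : StablePair n m (torusEval p) v) : ‖weightedMap v p‖ = 1 := by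
  refine norm_eq_one_of_inner_self ?_
  rw [weightedMap_apply, h.mul_eq_one, inner_toL2, star_one, one_mul]
  simpa using torusMean_torusMonomial 0

lemma norm_weightedMap_reflection (h : StablePair n m (torusEval p) v)
    (hr : torusEval r = torusMonomial (n, m) * star (torusEval p)) : ‖weightedMap v r‖ = 1 := by
  rw [weightedMap_apply, hr, mul_assoc, norm_toL2_torusMonomial_mul]
  refine norm_eq_one_of_inner_self ?_
  have : star (star (torusEval p) * v) * (star (torusEval p) * v) = torusMonomial 0 := by
    rw [star_mul', star_star, torusMonomial_zero]
    linear_combination (star (torusEval p) * star v) * h.mul_eq_one + h.star_mul_eq_one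
  rw [inner_toL2, this, torusMean_torusMonomial, if_pos rfl]

/-- Since `p / p = 1`, these pairings are means of `v` times monomials with a positive exponent,
which vanish by analyticity. -/
lemma inner_weightedMap_self (h : StablePair n m (torusEval p) v) {f : Poly2}
    (hf : torusEval f ∈ trigSupported {k | 0 < k.1 ∨ 0 < k.2}) :
    ⟪weightedMap v p, weightedMap v f⟫_ℂ = 0 := by
  rw [← inner_eq_zero_symm]
  refine inner_weightedMap_eq_zero (fun k hk => ?_) hf
  rw [weightedMap_apply, h.mul_eq_one, ← inner_eq_zero_symm, inner_toL2, star_one, one_mul]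
  exact h.mean_eq_zero k hk

lemma inner_weightedMap_reflection (h : StablePair n m (torusEval p) v)
    (hr : torusEval r = torusMonomial (n, m) * star (torusEval p)) {f : Poly2}
    (hf : torusEval f ∈ trigSupported {k | k.1 < n ∨ k.2 < m}) :
    ⟪weightedMap v r, weightedMap v f⟫_ℂ = 0 := by
  rw [← inner_eq_zero_symm]
  refine inner_weightedMap_eq_zero (fun k hk => ?_) hf
  have : star (torusMonomial k * v) * (torusEval r * v)
      = torusMonomial (((n : ℤ), (m : ℤ)) - k) * v := by
    rw [hr, sub_eq_add_neg, ← torusMonomial_mul, star_mul', star_torusMonomial]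
    linear_combination (torusMonomial ((n : ℤ), (m : ℤ)) * torusMonomial (-k) * v)
      * h.star_mul_eq_one
  rw [weightedMap_apply, inner_toL2, this]
  refine h.mean_eq_zero _ ?_
  simp only [Set.mem_ofPred_eq, Prod.fst_sub, Prod.snd_sub] at *
  lia

/-- Evaluation at a point as a linear functional. -/
noncomputable def evLinear (z w : ℂ) : Poly2 →ₗ[ℂ] ℂ := (aeval ![z, w]).toLinearMap

lemma evLinear_apply (z w : ℂ) (f : Poly2) : evLinear z w f = ev f z w := by
  rw [ev, ← coe_aeval_eq_eval]; rfl

lemma monomial_eq_X_mul {k : Fin 2 →₀ ℕ} {i : Fin 2} (hk : 0 < k i) :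
    (monomial k 1 : Poly2) = X i * monomial (k - Finsupp.single i 1) 1 := by
  rw [X, monomial_mul, one_mul, add_tsub_cancel_of_le]
  rwa [Finsupp.single_le_iff, Nat.one_le_iff_ne_zero, ← Nat.pos_iff_ne_zero]

/-- A polynomial with a nonzero `k₀` coefficient complements a subspace containing all other
monomials. -/
lemma sup_eq_of_coeff_ne_zero {M : Submodule ℂ Poly2} {a b : ℕ} (hM : M ≤ degreeLtLt a b)
    (k₀ : Fin 2 →₀ ℕ) (h : ∀ k : Fin 2 →₀ ℕ, k 0 < a → k 1 < b → k ≠ k₀ → monomial k 1 ∈ M)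
    {f : Poly2} (hf : f ∈ degreeLtLt a b) (hc : coeff k₀ f ≠ 0) :
    span ℂ {f} ⊔ M = degreeLtLt a b := by
  have key : ∀ g ∈ degreeLtLt a b, g - coeff k₀ g • monomial k₀ (1 : ℂ) ∈ M := by
    intro g hg
    have := degreeLtLt_le (N := M.comap (LinearMap.id -
      (lcoeff ℂ k₀).smulRight (monomial k₀ (1 : ℂ)))) (fun k h0 h1 => ?_) hg
    · exact this
    by_cases hk : k = k₀
    · simp [hk]
    · simpa [hk, coeff_monomial] using h k h0 h1 hk
  refine le_antisymm (sup_le ((span_singleton_le_iff_mem _ _).2 hf) hM) fun g hg => ?_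
  refine mem_sup.2 ⟨(coeff k₀ g / coeff k₀ f) • f, mem_span_singleton.2 ⟨_, rfl⟩,
    (g - coeff k₀ g • monomial k₀ (1 : ℂ)) - (coeff k₀ g / coeff k₀ f) •
      (f - coeff k₀ f • monomial k₀ (1 : ℂ)), sub_mem (key g hg) (smul_mem _ _ (key f hf)), ?_⟩
  rw [smul_sub, smul_smul, div_mul_cancel₀ _ hc]
  abel

/-- Multiplication by a variable. -/
noncomputable abbrev mulX (i : Fin 2) : Poly2 →ₗ[ℂ] Poly2 := LinearMap.mulLeft ℂ (X i)

lemma map_mulX_zero_le (a b : ℕ) : (degreeLtLt a b).map (mulX 0) ≤ degreeLtLt (a + 1) b := by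
  rw [map_le_iff_le_comap]
  refine degreeLtLt_le fun k h0 h1 => ?_
  rw [mem_comap, LinearMap.mulLeft_apply, X, monomial_mul, one_mul]
  exact monomial_mem_degreeLtLt (by simp; lia) (by simpa using h1)

lemma map_mulX_one_le (a b : ℕ) : (degreeLtLt a b).map (mulX 1) ≤ degreeLtLt a (b + 1) := by
  rw [map_le_iff_le_comap]
  refine degreeLtLt_le fun k h0 h1 => ?_
  rw [mem_comap, LinearMap.mulLeft_apply, X, monomial_mul, one_mul]
  exact monomial_mem_degreeLtLt (by simpa using h0) (by simp; lia)

lemma span_sup_map_mulX (hp : p ∈ degreeLtLt (n + 1) (m + 1)) (hc : coeff 0 p ≠ 0) :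
    span ℂ {p} ⊔ ((degreeLtLt n (m + 1)).map (mulX 0) ⊔ (degreeLtLt (n + 1) m).map (mulX 1))
      = degreeLtLt (n + 1) (m + 1) := by
  refine sup_eq_of_coeff_ne_zero (sup_le (map_mulX_zero_le _ _) (map_mulX_one_le _ _)) 0
    (fun k h0 h1 hk => ?_) hp hc
  by_cases hk0 : k 0 = 0
  · have hk1 : 0 < k 1 := by
      refine Nat.pos_of_ne_zero fun hk1 => hk ?_
      ext i
      fin_cases i
      exacts [hk0, hk1]
    exact mem_sup_right (mem_map.2 ⟨monomial (k - Finsupp.single 1 1) 1,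
      monomial_mem_degreeLtLt (by simpa using h0) (by simp; lia), (monomial_eq_X_mul hk1).symm⟩)
  · exact mem_sup_left (mem_map.2 ⟨monomial (k - Finsupp.single 0 1) 1,
      monomial_mem_degreeLtLt (by simp; lia) (by simpa using h1),
      (monomial_eq_X_mul (Nat.pos_of_ne_zero hk0)).symm⟩)

lemma span_sup_degreeLtLt (hr : r ∈ degreeLtLt (n + 1) (m + 1))
    (hc : coeff (Finsupp.equivFunOnFinite.symm ![n, m]) r ≠ 0) :
    span ℂ {r} ⊔ (degreeLtLt n (m + 1) ⊔ degreeLtLt (n + 1) m)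
      = degreeLtLt (n + 1) (m + 1) := by
  refine sup_eq_of_coeff_ne_zero (sup_le (degreeLtLt_mono (Nat.le_succ _) le_rfl)
    (degreeLtLt_mono le_rfl (Nat.le_succ _))) _ (fun k h0 h1 hk => ?_) hr hc
  by_cases hk0 : k 0 < n
  · exact mem_sup_left (monomial_mem_degreeLtLt hk0 h1)
  · refine mem_sup_right (monomial_mem_degreeLtLt h0 ?_)
    by_contra hk1
    refine hk ?_
    ext i
    fin_cases i
    · exact le_antisymm (Nat.lt_succ_iff.1 h0) (not_lt.1 hk0)
    · exact le_antisymm (Nat.lt_succ_iff.1 h1) (not_lt.1 hk1)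

lemma torusEval_mem_of_mem_sup_map {f : Poly2}
    (hf : f ∈ (degreeLtLt n (m + 1)).map (mulX 0) ⊔ (degreeLtLt (n + 1) m).map (mulX 1)) :
    torusEval f ∈ trigSupported {k | 0 < k.1 ∨ 0 < k.2} := by
  have e0 : torusEval (X 0) = torusMonomial (1, 0) := by simp [torusEval]
  have e1 : torusEval (X 1) = torusMonomial (0, 1) := by simp [torusEval]
  have hle : (degreeLtLt n (m + 1)).map (mulX 0) ⊔ (degreeLtLt (n + 1) m).map (mulX 1)
      ≤ (trigSupported {k | 0 < k.1 ∨ 0 < k.2}).comap torusEval.toLinearMap := by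
    refine sup_le ?_ ?_
    · rw [map_le_iff_le_comap]
      intro f hf
      rw [mem_comap, mem_comap, LinearMap.mulLeft_apply, AlgHom.toLinearMap_apply, map_mul, e0]
      refine mul_mem_trigSupported (torusMonomial_mem (Set.mem_singleton _))
        (torusEval_mem hf (s := {k | 0 ≤ k.1}) fun k _ _ => by simp [expPair]) ?_
      rintro _ rfl ⟨i, j⟩ hk
      simp only [Set.mem_ofPred_eq, Prod.fst_add, Prod.snd_add] at *
      lia
    · rw [map_le_iff_le_comap]
      intro f hf
      rw [mem_comap, mem_comap, LinearMap.mulLeft_apply, AlgHom.toLinearMap_apply, map_mul, e1]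
      refine mul_mem_trigSupported (torusMonomial_mem (Set.mem_singleton _))
        (torusEval_mem hf (s := {k | 0 ≤ k.2}) fun k _ _ => by simp [expPair]) ?_
      rintro _ rfl ⟨i, j⟩ hk
      simp only [Set.mem_ofPred_eq, Prod.fst_add, Prod.snd_add] at *
      lia
  exact hle hf

lemma torusEval_mem_of_mem_sup {f : Poly2}
    (hf : f ∈ degreeLtLt n (m + 1) ⊔ degreeLtLt (n + 1) m) :
    torusEval f ∈ trigSupported {k | k.1 < n ∨ k.2 < m} := by
  have hle : degreeLtLt n (m + 1) ⊔ degreeLtLt (n + 1) m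
      ≤ (trigSupported {k | k.1 < n ∨ k.2 < m}).comap torusEval.toLinearMap :=
    sup_le (fun f hf => torusEval_mem hf fun k h0 h1 => Or.inl (by simpa [expPair] using h0))
      (fun f hf => torusEval_mem hf fun k h0 h1 => Or.inr (by simpa [expPair] using h1))
  exact hle hf

lemma coeff_reflection (hr : torusEval r = torusMonomial (n, m) * star (torusEval p)) :
    coeff (Finsupp.equivFunOnFinite.symm ![n, m]) r = star (coeff 0 p) := by
  have h1 := torusMean_mul_torusEval 0 p
  have h2 := torusMean_mul_torusEval (Finsupp.equivFunOnFinite.symm ![n, m]) r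
  have h3 : expPair (Finsupp.equivFunOnFinite.symm ![n, m]) = ((n : ℤ), (m : ℤ)) := by
    simp [expPair]
  have h4 : expPair 0 = 0 := rfl
  rw [h3, hr, ← mul_assoc, torusMonomial_mul, neg_add_cancel, torusMonomial_zero, one_mul,
    torusMean_star] at h2
  rw [h4, neg_zero, torusMonomial_zero, one_mul] at h1
  rw [← h2, h1]

/-- The two-variable Christoffel–Darboux formula for a polynomial without zeros on the closed
bidisk. -/
theorem exists_christoffelDarboux (n m : ℕ) (p r : Poly2) (hp : p ∈ degreeLtLt (n + 1) (m + 1))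
    (hr : r ∈ degreeLtLt (n + 1) (m + 1))
    (hstable : ∀ z w : ℂ, ‖z‖ ≤ 1 → ‖w‖ ≤ 1 → ev p z w ≠ 0)
    (href : ∀ z w : ℂ, ‖z‖ = 1 → ‖w‖ = 1 → ev r z w = z ^ n * w ^ m * star (ev p z w)) :
    ∃ (A : Fin n → Poly2) (B : Fin m → Poly2), (∀ i, A i ∈ degreeLtLt n (m + 1)) ∧
      (∀ j, B j ∈ degreeLtLt (n + 1) m) ∧ ∀ z w : ℂ, ‖ev p z w‖ ^ 2 - ‖ev r z w‖ ^ 2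
        = (1 - ‖z‖ ^ 2) * vecNormSq A z w + (1 - ‖w‖ ^ 2) * vecNormSq B z w := by
  obtain ⟨v, hv, hpv⟩ := exists_mem_topologicalClosure_mul_eq_one
    ![torusMonomial (1, 0), torusMonomial (0, 1)] (fun i => by
      fin_cases i <;> simp [norm_torusMonomial]) p hstable
  have h : StablePair n m (torusEval p) v := stablePair_torusEval hp hv hpv
  have hr' := torusEval_eq_of_reflection href
  have hc0 : coeff 0 p ≠ 0 := by
    have := hstable 0 0 (by simp) (by simp)
    have hz : ![(0 : ℂ), 0] = 0 := by simp
    rwa [ev, hz, eval_zero, constantCoeff_eq] at this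
  have hctop : coeff (Finsupp.equivFunOnFinite.symm ![n, m]) r ≠ 0 := by
    rw [coeff_reflection hr']
    exact star_ne_zero.2 hc0
  -- The inner product of `L²(𝕋², 1/|p|²)`, for which multiplication by `z` or `w` is isometric.
  let _ : NormedAddCommGroup Poly2 := NormedAddCommGroup.induced Poly2 _ (weightedMap v)
    (weightedMap_injective h)
  let _ : InnerProductSpace ℂ Poly2 := InnerProductSpace.induced (weightedMap v)
  let S : Poly2 →ₗᵢ[ℂ] Poly2 := ⟨mulX 0, norm_weightedMap_X_mul v 0⟩
  let T : Poly2 →ₗᵢ[ℂ] Poly2 := ⟨mulX 1, norm_weightedMap_X_mul v 1⟩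
  have hX {a b : ℕ} {f : Poly2} (hf : f ∈ degreeLtLt a b) : X 0 * f ∈ degreeLtLt (a + 1) b :=
    map_mulX_zero_le a b (mem_map_of_mem hf)
  have hY {a b : ℕ} {f : Poly2} (hf : f ∈ degreeLtLt a b) : X 1 * f ∈ degreeLtLt a (b + 1) :=
    map_mulX_one_le a b (mem_map_of_mem hf)
  obtain ⟨A, B, hA, hB, hAB⟩ := exists_sum_sq_of_orthogonal_decompositions S T
    (degreeLtLt n (m + 1)) (degreeLtLt (n + 1) m) (degreeLtLt n m) n m
    (degreeLtLt_mono le_rfl (Nat.le_succ _)) (degreeLtLt_mono (Nat.le_succ _) le_rfl)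
    (map_mulX_zero_le n m)
    (by
      rintro _ ⟨f, hf, rfl⟩
      exact ⟨X 0 * f, hX hf, mul_left_comm _ _ _⟩)
    (by
      rintro _ ⟨f, hf, rfl⟩
      exact ⟨X 1 * f, hY hf, rfl⟩)
    (by simp only [finrank_degreeLtLt]; ring)
    (by simp only [finrank_degreeLtLt]; ring)
    (fun f hf hfo g hg => weightedMap_orthogonal h hp hstable hf hfo hg)
    (by
      rintro _ ⟨f, hf, rfl⟩ hfo _ ⟨g, hg, rfl⟩
      exact weightedMap_orthogonal_reflected h hp hstable hf
        (fun g hg => hfo _ ⟨g, hg, rfl⟩) hg)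
    p r (norm_weightedMap_self h) (norm_weightedMap_reflection h hr')
    (fun g hg => inner_weightedMap_self h (torusEval_mem_of_mem_sup_map hg))
    (fun g hg => inner_weightedMap_reflection h hr' (torusEval_mem_of_mem_sup hg))
    ((span_sup_map_mulX hp hc0).trans (span_sup_degreeLtLt hr hctop).symm)
  refine ⟨A, B, hA, hB, fun z w => ?_⟩
  have hz : ∀ f, evLinear z w (X 0 * f) = z * evLinear z w f := fun f => by simp [evLinear]
  have hw : ∀ f, evLinear z w (X 1 * f) = w * evLinear z w f := fun f => by simp [evLinear]
  simpa only [evLinear_apply, vecNormSq] using hAB (evLinear z w) z w hz hw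

end ChristoffelDarbouxFormula

/-! ### Limits of sums of squares, and derivatives. -/

section Limit

open Filter Topology

/-- `F` is a sum of squares on the bidisk with `n` and `m` squares of the expected degrees. -/
def IsBidiskSumSq (n m : ℕ) (F : ℂ → ℂ → ℝ) : Prop :=
  ∃ (A : Fin n → Poly2) (B : Fin m → Poly2), (∀ i, A i ∈ degreeLtLt n (m + 1)) ∧
    (∀ j, B j ∈ degreeLtLt (n + 1) m) ∧
    ∀ z w, F z w = (1 - ‖z‖ ^ 2) * vecNormSq A z w + (1 - ‖w‖ ^ 2) * vecNormSq B z w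

lemma ev_C_mul (c : ℂ) (f : Poly2) (z w : ℂ) : ev (C c * f) z w = c * ev f z w := by
  simp [ev]

lemma C_mul_mem_degreeLtLt {a b : ℕ} (c : ℂ) {f : Poly2} (hf : f ∈ degreeLtLt a b) :
    C c * f ∈ degreeLtLt a b := by
  rw [← smul_eq_C_mul]
  exact Submodule.smul_mem _ _ hf

lemma IsBidiskSumSq.const_mul {n m : ℕ} {F : ℂ → ℂ → ℝ} (h : IsBidiskSumSq n m F) {c : ℝ}
    (hc : 0 ≤ c) : IsBidiskSumSq n m fun z w => c * F z w := by
  obtain ⟨A, B, hA, hB, h⟩ := h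
  have key {k : ℕ} (P : Fin k → Poly2) (z w : ℂ) :
      vecNormSq (fun i => C (√c : ℂ) * P i) z w = c * vecNormSq P z w := by
    simp only [vecNormSq, ev_C_mul, norm_mul, mul_pow, Finset.mul_sum]
    simp [Real.sq_sqrt hc]
  refine ⟨fun i => C (√c : ℂ) * A i, fun j => C (√c : ℂ) * B j,
    fun i => C_mul_mem_degreeLtLt _ (hA i), fun j => C_mul_mem_degreeLtLt _ (hB j), fun z w => ?_⟩
  simp only [key, h]
  ring

lemma degreeOf_lt_of_mem {a b : ℕ} {f : Poly2} (hf : f ∈ degreeLtLt a b) (h0 : f ≠ 0) :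
    degreeOf 0 f < a ∧ degreeOf 1 f < b := by
  obtain ⟨k, hk⟩ := support_nonempty.2 h0
  have hk' := hf hk
  exact ⟨(degreeOf_lt_iff (Nat.zero_lt_of_lt hk'.1)).2 fun l hl => (hf hl).1,
    (degreeOf_lt_iff (Nat.zero_lt_of_lt hk'.2)).2 fun l hl => (hf hl).2⟩

/-- Polynomials of bounded bidegree can be reconstructed from finitely many values in the
bidisk. -/
lemma exists_interpolation (a b : ℕ) : ∃ (G : Finset (ℂ × ℂ)) (L : (G → ℂ) →ₗ[ℂ] Poly2),
    (∀ x ∈ G, ‖x.1‖ < 1 ∧ ‖x.2‖ < 1) ∧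
    ∀ f ∈ degreeLtLt a b, L (fun x : G => ev f x.1.1 x.1.2) = f := by
  have hinf : (Metric.ball (0 : ℂ) 1).Infinite :=
    infinite_of_mem_nhds 0 (Metric.ball_mem_nhds 0 one_pos)
  obtain ⟨S₀, hS₀, hc₀⟩ := hinf.exists_subset_card_eq a
  obtain ⟨S₁, hS₁, hc₁⟩ := hinf.exists_subset_card_eq b
  let Φ : Poly2 →ₗ[ℂ] ((S₀ ×ˢ S₁ : Finset (ℂ × ℂ)) → ℂ) :=
    LinearMap.pi fun x => evLinear x.1.1 x.1.2
  have hΦ (f : Poly2) : Φ f = fun x => ev f x.1.1 x.1.2 := by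
    ext x; exact evLinear_apply _ _ _
  have hker : LinearMap.ker (Φ ∘ₗ (degreeLtLt a b).subtype) = ⊥ := by
    rw [LinearMap.ker_eq_bot']
    rintro ⟨f, hf⟩ h0
    rw [Subtype.ext_iff]
    by_contra hf0
    refine hf0 (eq_zero_of_eval_zero_at_prod_finset f ![S₀, S₁] (fun i => ?_) fun x hx => ?_)
    · have := degreeOf_lt_of_mem hf hf0
      fin_cases i
      · exact this.1.trans_eq hc₀.symm
      · exact this.2.trans_eq hc₁.symm
    · have h1 : (x 0, x 1) ∈ S₀ ×ˢ S₁ := Finset.mem_product.2 ⟨hx 0, hx 1⟩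
      have h2 := congrFun h0 ⟨_, h1⟩
      have h3 : ![x 0, x 1] = x := by ext i; fin_cases i <;> rfl
      rw [LinearMap.comp_apply, Submodule.subtype_apply, hΦ] at h2
      simpa [ev, h3] using h2
  obtain ⟨L, hL⟩ := LinearMap.exists_leftInverse_of_injective _ hker
  refine ⟨S₀ ×ˢ S₁, (degreeLtLt a b).subtype ∘ₗ L, fun x hx => ?_, fun f hf => ?_⟩
  · rw [Finset.mem_product] at hx
    exact ⟨by simpa using hS₀ hx.1, by simpa using hS₁ hx.2⟩
  · have := LinearMap.congr_fun hL ⟨f, hf⟩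
    rw [LinearMap.comp_apply, LinearMap.comp_apply, Submodule.subtype_apply, hΦ] at this
    exact congrArg Subtype.val this

/-- Sums of squares on the bidisk are closed under pointwise limits. -/
theorem IsBidiskSumSq.of_tendsto {n m : ℕ} {F : ℕ → ℂ → ℂ → ℝ} {F' : ℂ → ℂ → ℝ}
    (h : ∀ k, IsBidiskSumSq n m (F k))
    (hF : ∀ z w, Tendsto (fun k => F k z w) atTop (𝓝 (F' z w))) : IsBidiskSumSq n m F' := by
  choose A B hA hB hAB using h
  obtain ⟨G, L, hG, hL⟩ := exists_interpolation (n + 1) (m + 1)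
  let P : ℕ → Fin n ⊕ Fin m → Poly2 := fun k => Sum.elim (A k) (B k)
  let c : ℕ → Fin n ⊕ Fin m → G → ℂ := fun k i x => ev (P k i) x.1.1 x.1.2
  have hP (k i) : L (c k i) = P k i := by
    refine hL _ ?_
    rcases i with i | i
    · exact degreeLtLt_mono (Nat.le_succ _) le_rfl (hA k i)
    · exact degreeLtLt_mono le_rfl (Nat.le_succ _) (hB k i)
  -- Inside the bidisk both weights are positive, so the convergent values of `F k` bound each
  -- square separately. Values on the grid `G` determine the polynomials linearly, which reduces
  -- compactness to finite dimensions.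
  have hbound (x : G) : ∃ R, ∀ k i, ‖c k i x‖ ≤ R := by
    obtain ⟨M, hM⟩ := (hF x.1.1 x.1.2).bddAbove_range
    have hM' (k) : F k x.1.1 x.1.2 ≤ M := hM ⟨k, rfl⟩
    have h1 : 0 < 1 - ‖x.1.1‖ ^ 2 := by nlinarith [(hG x.1 x.2).1, norm_nonneg x.1.1]
    have h2 : 0 < 1 - ‖x.1.2‖ ^ 2 := by nlinarith [(hG x.1 x.2).2, norm_nonneg x.1.2]
    have hnn {k : ℕ} (Q : Fin k → Poly2) (z w : ℂ) : 0 ≤ vecNormSq Q z w :=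
      Finset.sum_nonneg fun i _ => by positivity
    have hle {k : ℕ} (Q : Fin k → Poly2) (z w : ℂ) (i) : ‖ev (Q i) z w‖ ^ 2 ≤ vecNormSq Q z w :=
      Finset.single_le_sum (f := fun i => ‖ev (Q i) z w‖ ^ 2) (fun i _ => by positivity)
        (Finset.mem_univ i)
    refine ⟨√(M / (1 - ‖x.1.1‖ ^ 2)) + √(M / (1 - ‖x.1.2‖ ^ 2)), fun k i => ?_⟩
    have hk := (hAB k x.1.1 x.1.2).symm.trans_le (hM' k)
    rcases i with i | i
    · refine (Real.le_sqrt_of_sq_le ?_).trans (le_add_of_nonneg_right (Real.sqrt_nonneg _))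
      rw [le_div_iff₀ h1]
      have := mul_le_mul_of_nonneg_right (hle (A k) x.1.1 x.1.2 i) h1.le
      have := mul_nonneg h2.le (hnn (B k) x.1.1 x.1.2)
      change ‖ev (A k i) _ _‖ ^ 2 * _ ≤ _
      linarith
    · refine (Real.le_sqrt_of_sq_le ?_).trans (le_add_of_nonneg_left (Real.sqrt_nonneg _))
      rw [le_div_iff₀ h2]
      have := mul_le_mul_of_nonneg_right (hle (B k) x.1.1 x.1.2 i) h2.le
      have := mul_nonneg h1.le (hnn (A k) x.1.1 x.1.2)
      change ‖ev (B k i) _ _‖ ^ 2 * _ ≤ _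
      linarith
  choose R hR using hbound
  have hcomp : IsCompact (Set.univ.pi fun _ : Fin n ⊕ Fin m =>
      Set.univ.pi fun x : G => Metric.closedBall (0 : ℂ) (R x)) :=
    isCompact_univ_pi fun _ => isCompact_univ_pi fun x => isCompact_closedBall _ _
  obtain ⟨d, -, φ, hφ, hd⟩ := hcomp.tendsto_subseq (x := c) fun k i _ x _ => by
    simpa using hR x k i
  have hdi (i) : Tendsto (fun k => c (φ k) i) atTop (𝓝 (d i)) := (tendsto_pi_nhds.1 hd) i
  have hev (i) (z w : ℂ) : Tendsto (fun k => ev (P (φ k) i) z w) atTop (𝓝 (ev (L (d i)) z w)) := by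
    have hcont := LinearMap.continuous_of_finiteDimensional (evLinear z w ∘ₗ L)
    have := (hcont.tendsto (d i)).comp (hdi i)
    simpa [Function.comp_def, evLinear_apply, hP] using this
  have hmem (i) (N : Submodule ℂ Poly2) (h : ∀ k, P k i ∈ N) : L (d i) ∈ N := by
    have hcl : IsClosed ((N.comap L : Submodule ℂ (G → ℂ)) : Set (G → ℂ)) :=
      Submodule.closed_of_finiteDimensional _
    exact hcl.mem_of_tendsto (hdi i) (Eventually.of_forall fun k => by
      change L _ ∈ N
      rw [hP]; exact h _)
  refine ⟨fun i => L (d (Sum.inl i)), fun j => L (d (Sum.inr j)), fun i => hmem _ _ fun k => hA k i,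
    fun j => hmem _ _ fun k => hB k j, fun z w => ?_⟩
  refine tendsto_nhds_unique ((hF z w).comp hφ.tendsto_atTop) ?_
  have hA' : Tendsto (fun k => vecNormSq (A (φ k)) z w) atTop
      (𝓝 (vecNormSq (fun i => L (d (Sum.inl i))) z w)) :=
    tendsto_finsetSum _ fun i _ => ((hev (Sum.inl i) z w).norm).pow 2
  have hB' : Tendsto (fun k => vecNormSq (B (φ k)) z w) atTop
      (𝓝 (vecNormSq (fun i => L (d (Sum.inr i))) z w)) :=
    tendsto_finsetSum _ fun i _ => ((hev (Sum.inr i) z w).norm).pow 2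
  simp only [Function.comp_def, hAB]
  exact (hA'.const_mul _).add (hB'.const_mul _)

lemma hasDerivAt_ev (q : Poly2) {u v : ℝ → ℂ} {u' v' : ℂ} {t : ℝ} (hu : HasDerivAt u u' t)
    (hv : HasDerivAt v v' t) : HasDerivAt (fun s => ev q (u s) (v s))
      (u' * ev (pderiv 0 q) (u t) (v t) + v' * ev (pderiv 1 q) (u t) (v t)) t := by
  induction q using MvPolynomial.induction_on with
  | C a => simpa [ev] using hasDerivAt_const t a
  | add p q hp hq =>
    have e (p q : Poly2) (z w : ℂ) : ev (p + q) z w = ev p z w + ev q z w := map_add _ _ _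
    simp only [map_add, e]
    exact (hp.add hq).congr_deriv (by ring)
  | mul_X p i hp =>
    have e (p q : Poly2) (z w : ℂ) : ev (p * q) z w = ev p z w * ev q z w := map_mul _ _ _
    have e' (p q : Poly2) (z w : ℂ) : ev (p + q) z w = ev p z w + ev q z w := map_add _ _ _
    simp only [Derivation.leibniz, smul_eq_mul, e, e', pderiv_X]
    fin_cases i
    · refine (HasDerivAt.congr_deriv (hp.mul hu) ?_).congr_of_eventuallyEq
        (Eventually.of_forall fun s => by simp [ev])
      simp [ev]
      ring
    · refine (HasDerivAt.congr_deriv (hp.mul hv) ?_).congr_of_eventuallyEq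
        (Eventually.of_forall fun s => by simp [ev])
      simp [ev]
      ring

lemma hasDerivAt_norm_sq_ev (q : Poly2) {u v : ℝ → ℂ} {u' v' : ℂ} {t : ℝ} (hu : HasDerivAt u u' t)
    (hv : HasDerivAt v v' t) : HasDerivAt (fun s => ‖ev q (u s) (v s)‖ ^ 2)
      (2 * ((u' * ev (pderiv 0 q) (u t) (v t) + v' * ev (pderiv 1 q) (u t) (v t))
        * star (ev q (u t) (v t))).re) t := by
  convert (hasDerivAt_ev q hu hv).norm_sq using 1
  rw [Complex.inner]
  rfl

end Limit

/-! ### Dilations and the sum of squares formula. -/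

section Existence

open Filter Topology

/-- The polynomial `q(α z, β w)`. -/
noncomputable def dilate (α β : ℂ) : Poly2 →ₐ[ℂ] Poly2 := aeval ![C α * X 0, C β * X 1]

lemma ev_dilate (α β : ℂ) (q : Poly2) (z w : ℂ) : ev (dilate α β q) z w = ev q (α * z) (β * w) := by
  induction q using MvPolynomial.induction_on with
  | C a => simp [dilate, ev]
  | add p q hp hq =>
    simp only [ev, map_add] at hp hq ⊢
    rw [hp, hq]
  | mul_X p i hp =>
    simp only [ev, map_mul] at hp ⊢
    rw [hp]
    fin_cases i <;> simp [dilate]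

lemma dilate_mem {a b : ℕ} (α β : ℂ) {q : Poly2} (hq : q ∈ degreeLtLt a b) :
    dilate α β q ∈ degreeLtLt a b := by
  refine degreeLtLt_le (N := (degreeLtLt a b).comap (dilate α β).toLinearMap)
    (fun k h0 h1 => ?_) hq
  have : dilate α β (monomial k 1) = C (α ^ k 0 * β ^ k 1) * monomial k 1 := by
    rw [dilate, aeval_monomial, monomial_eq, Finsupp.prod_fintype _ _ (by simp),
      Finsupp.prod_fintype _ _ (by simp), Fin.prod_univ_two, Fin.prod_univ_two]
    simp
    ring
  rw [Submodule.mem_comap, AlgHom.toLinearMap_apply, this]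
  exact C_mul_mem_degreeLtLt _ (monomial_mem_degreeLtLt h0 h1)

lemma HasDegree.mem {q : Poly2} {n m : ℕ} (h : HasDegree q n m) :
    q ∈ degreeLtLt (n + 1) (m + 1) :=
  mem_degreeLtLt fun k hk => ⟨Nat.lt_succ_of_le ((degreeOf_le_iff.1 h.1.le) k hk),
    Nat.lt_succ_of_le ((degreeOf_le_iff.1 h.2.le) k hk)⟩

lemma norm_ofReal_exp_mul (x : ℝ) (z : ℂ) : ‖((Real.exp x : ℝ) : ℂ) * z‖ = Real.exp x * ‖z‖ := by
  rw [norm_mul, Complex.norm_real, Real.norm_of_nonneg (Real.exp_pos x).le]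

variable {n m : ℕ} {q : Poly2}

/-- The difference quotients of the dilations of a symmetric polynomial are sums of squares. -/
lemma isBidiskSumSq_dilate (hdeg : HasDegree q n m) (hsymm : IsTorusSymmetric q n m)
    (hzero : NoZerosOnBidisk q) {a b s : ℝ} (ha : 0 < a) (hb : 0 < b) (hs : 0 < s) :
    IsBidiskSumSq n m fun z w =>
      ‖ev q ((Real.exp (-(a * s)) : ℝ) * z) ((Real.exp (-(b * s)) : ℝ) * w)‖ ^ 2
        - Real.exp (-(a * n + b * m) * s) ^ 2
          * ‖ev q ((Real.exp (a * s) : ℝ) * z) ((Real.exp (b * s) : ℝ) * w)‖ ^ 2 := by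
  have hlt {c : ℝ} (hc : 0 < c) {z : ℂ} (hz : ‖z‖ ≤ 1) :
      ‖((Real.exp (-(c * s)) : ℝ) : ℂ) * z‖ < 1 := by
    rw [norm_ofReal_exp_mul]
    have : Real.exp (-(c * s)) < 1 := Real.exp_lt_one_iff.2 (by nlinarith)
    nlinarith [Real.exp_pos (-(c * s)), norm_nonneg z]
  obtain ⟨A, B, hA, hB, h⟩ := exists_christoffelDarboux n m
    (dilate (Real.exp (-(a * s)) : ℝ) (Real.exp (-(b * s)) : ℝ) q)
    (C ((Real.exp (-(a * n + b * m) * s) : ℝ) : ℂ) *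
      dilate (Real.exp (a * s) : ℝ) (Real.exp (b * s) : ℝ) q)
    (dilate_mem _ _ hdeg.mem) (C_mul_mem_degreeLtLt _ (dilate_mem _ _ hdeg.mem))
    (fun z w hz hw => by
      rw [ev_dilate]
      exact hzero _ _ (hlt ha hz) (hlt hb hw))
    (fun z w hz hw => by
      have hz0 : z ≠ 0 := norm_ne_zero_iff.1 (by rw [hz]; exact one_ne_zero)
      have hw0 : w ≠ 0 := norm_ne_zero_iff.1 (by rw [hw]; exact one_ne_zero)
      have he (x : ℝ) : ((Real.exp x : ℝ) : ℂ) ≠ 0 := by exact_mod_cast (Real.exp_pos x).ne'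
      have hinv {z : ℂ} (hz : ‖z‖ = 1) (x : ℝ) :
          1 / star (((Real.exp x : ℝ) : ℂ) * z) = ((Real.exp (-x) : ℝ) : ℂ) * z := by
        have h1 : star z * z = 1 := by
          rw [mul_comm]
          have := Complex.mul_conj z
          rw [Complex.normSq_eq_norm_sq, hz] at this
          simpa using this
        have h2 : star (((Real.exp x : ℝ) : ℂ)) = ((Real.exp x : ℝ) : ℂ) := Complex.conj_ofReal _
        have h3 : ((Real.exp x : ℝ) : ℂ) * ((Real.exp (-x) : ℝ) : ℂ) = 1 := by
          rw [← Complex.ofReal_mul, ← Real.exp_add, add_neg_cancel, Real.exp_zero,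
            Complex.ofReal_one]
        rw [star_mul', h2, div_eq_iff (mul_ne_zero (he x) (star_ne_zero.2
          (norm_ne_zero_iff.1 (by rw [hz]; exact one_ne_zero))))]
        linear_combination -h1 - (star z * z) * h3
      rw [ev_C_mul, ev_dilate, ev_dilate, hsymm _ _ (mul_ne_zero (he _) hz0)
        (mul_ne_zero (he _) hw0), reflection, hinv hz, hinv hw, mul_pow, mul_pow,
        ← Complex.ofReal_pow, ← Complex.ofReal_pow, ← Real.exp_nat_mul, ← Real.exp_nat_mul]
      -- The scalar in front of the reflection offsets the factors `e^{nas}` and `e^{mbs}` from `z^n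
      -- w^m` at the dilated point.
      have h4 : ((Real.exp (-(a * n + b * m) * s) : ℝ) : ℂ) *
          (((Real.exp (n * (a * s)) : ℝ) : ℂ) * ((Real.exp (m * (b * s)) : ℝ) : ℂ)) = 1 := by
        rw [← Complex.ofReal_mul, ← Complex.ofReal_mul, ← Real.exp_add, ← Real.exp_add,
          ← Complex.ofReal_one, ← Real.exp_zero]
        congr 2
        ring
      linear_combination (z ^ n * w ^ m * star (ev q (((Real.exp (-(a * s)) : ℝ) : ℂ) * z)
        (((Real.exp (-(b * s)) : ℝ) : ℂ) * w))) * h4)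
  refine ⟨A, B, hA, hB, fun z w => ?_⟩
  rw [← h z w, ev_C_mul, ev_dilate, ev_dilate, norm_mul, mul_pow, Complex.norm_real,
    Real.norm_of_nonneg (Real.exp_pos _).le]

/-- The left hand side of the sum of squares formula. -/
noncomputable def sosForm (q : Poly2) (n m : ℕ) (a b : ℝ) (z w : ℂ) : ℝ :=
  (a * n + b * m) * ‖ev q z w‖ ^ 2
    - 2 * (((a : ℂ) * z * ev (pderiv 0 q) z w + (b : ℂ) * w * ev (pderiv 1 q) z w)
      * star (ev q z w)).re

lemma hasDerivAt_exp_mul (c : ℝ) (z : ℂ) :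
    HasDerivAt (fun s : ℝ => ((Real.exp (c * s) : ℝ) : ℂ) * z) (c * z) 0 := by
  have h : HasDerivAt (fun s : ℝ => Real.exp (c * s)) c 0 := by
    simpa using ((hasDerivAt_id (0 : ℝ)).const_mul c).exp
  exact h.ofReal_comp.mul_const z

/-- The inner dilation, the outer dilation and the scalar all contribute, which gives the factor
`2`. The function vanishes at `s = 0`, so its quotients by `s` converge to this derivative. -/
lemma hasDerivAt_dilate (q : Poly2) (n m : ℕ) (a b : ℝ) (z w : ℂ) :
    HasDerivAt (fun s : ℝ =>
      ‖ev q ((Real.exp (-(a * s)) : ℝ) * z) ((Real.exp (-(b * s)) : ℝ) * w)‖ ^ 2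
        - Real.exp (-(a * n + b * m) * s) ^ 2
          * ‖ev q ((Real.exp (a * s) : ℝ) * z) ((Real.exp (b * s) : ℝ) * w)‖ ^ 2)
      (2 * sosForm q n m a b z w) 0 := by
  have h1 := hasDerivAt_norm_sq_ev q (hasDerivAt_exp_mul (-a) z) (hasDerivAt_exp_mul (-b) w)
  have h2 := hasDerivAt_norm_sq_ev q (hasDerivAt_exp_mul a z) (hasDerivAt_exp_mul b w)
  have h3 : HasDerivAt (fun s : ℝ => Real.exp (-(a * n + b * m) * s) ^ 2)
      (2 * -(a * n + b * m)) 0 := by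
    have h : HasDerivAt (fun s : ℝ => Real.exp (-(a * n + b * m) * s)) (-(a * n + b * m)) 0 := by
      simpa using ((hasDerivAt_id (0 : ℝ)).const_mul (-(a * n + b * m))).exp
    exact (h.pow 2).congr_deriv (by simp)
  simp only [neg_mul] at h1
  refine (h1.sub (h3.mul h2)).congr_deriv ?_
  simp only [sosForm, mul_zero, Real.exp_zero, neg_zero, Complex.ofReal_one, one_mul, one_pow,
    Complex.ofReal_neg, neg_mul]
  have : ((-((a : ℂ) * z * ev (pderiv 0 q) z w) + -((b : ℂ) * w * ev (pderiv 1 q) z w))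
      * star (ev q z w)).re = -((((a : ℂ) * z * ev (pderiv 0 q) z w
        + (b : ℂ) * w * ev (pderiv 1 q) z w) * star (ev q z w)).re) := by
    rw [← Complex.neg_re]
    congr 1
    ring
  rw [this]
  ring

lemma isBidiskSumSq_sosForm_of_pos (hdeg : HasDegree q n m) (hsymm : IsTorusSymmetric q n m)
    (hzero : NoZerosOnBidisk q) {a b : ℝ} (ha : 0 < a) (hb : 0 < b) :
    IsBidiskSumSq n m (sosForm q n m a b) := by
  have hs (k : ℕ) : (0 : ℝ) < 1 / ((k : ℝ) + 1) := by positivity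
  refine IsBidiskSumSq.of_tendsto (fun k => (isBidiskSumSq_dilate hdeg hsymm hzero ha hb
    (hs k)).const_mul (c := (1 / 2) * (1 / ((k : ℝ) + 1))⁻¹) (by positivity)) fun z w => ?_
  have hseq : Tendsto (fun k : ℕ => 1 / ((k : ℝ) + 1)) atTop (𝓝[>] 0) :=
    tendsto_nhdsWithin_iff.2 ⟨tendsto_one_div_add_atTop_nhds_zero_nat, Eventually.of_forall hs⟩
  have := ((hasDerivAt_dilate q n m a b z w).tendsto_slope_zero_right.comp hseq).const_mul (1 / 2)
  have e : (1 / 2 : ℝ) * (2 * sosForm q n m a b z w) = sosForm q n m a b z w := by ring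
  rw [e] at this
  refine this.congr fun k => ?_
  simp [mul_assoc]

theorem isBidiskSumSq_sosForm (hdeg : HasDegree q n m) (hsymm : IsTorusSymmetric q n m)
    (hzero : NoZerosOnBidisk q) {a b : ℝ} (ha : 0 ≤ a) (hb : 0 ≤ b) :
    IsBidiskSumSq n m (sosForm q n m a b) := by
  have hs (k : ℕ) : (0 : ℝ) < 1 / ((k : ℝ) + 1) := by positivity
  -- With a zero weight the dilation would not bring the closed bidisk into the open one; both
  -- weights are perturbed by `1 / (k + 1)`.
  refine IsBidiskSumSq.of_tendsto (fun k => isBidiskSumSq_sosForm_of_pos hdeg hsymm hzero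
    (add_pos_of_nonneg_of_pos ha (hs k)) (add_pos_of_nonneg_of_pos hb (hs k))) fun z w => ?_
  have hc : Continuous fun t : ℝ => sosForm q n m (a + t) (b + t) z w := by
    simp only [sosForm]
    fun_prop
  simpa [Function.comp_def] using (hc.tendsto 0).comp tendsto_one_div_add_atTop_nhds_zero_nat

lemma degreeAtMost_of_mem {a b : ℕ} {f : Poly2} (hf : f ∈ degreeLtLt (a + 1) (b + 1)) :
    DegreeAtMost f a b := by
  by_cases h0 : f = 0
  · simp [h0, DegreeAtMost]
  · have := degreeOf_lt_of_mem hf h0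
    exact ⟨Nat.lt_succ_iff.1 this.1, Nat.lt_succ_iff.1 this.2⟩

theorem exists_isSOSPair (hdeg : HasDegree q n m) (hsymm : IsTorusSymmetric q n m)
    (hzero : NoZerosOnBidisk q) {a b : ℝ} (ha : 0 ≤ a) (hb : 0 ≤ b) :
    ∃ (A : Fin n → Poly2) (B : Fin m → Poly2), IsSOSPair q n m a b A B := by
  obtain ⟨A, B, hA, hB, h⟩ := isBidiskSumSq_sosForm hdeg hsymm hzero ha hb
  refine ⟨A, B, fun i => degreeAtMost_of_mem ?_, fun j => degreeAtMost_of_mem ?_, h⟩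
  · rw [Nat.sub_add_cancel (Nat.one_le_of_lt i.2)]
    exact hA i
  · rw [Nat.sub_add_cancel (Nat.one_le_of_lt j.2)]
    exact hB j

end Existence

/-! ### Finiteness of the common zeros. -/

section Finiteness

/-- Over a factorial domain, an irreducible polynomial and a polynomial that it does not divide
have a nonzero constant combination. -/
lemma exists_mul_add_mul_eq_C {R : Type*} [CommRing R] [IsDomain R] [UniqueFactorizationMonoid R]
    {f g : Polynomial R} (hf : Irreducible f) (hfg : ¬ f ∣ g) :
    ∃ (c : R) (a b : Polynomial R), c ≠ 0 ∧ f * a + g * b = Polynomial.C c := by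
  by_cases h0 : f.natDegree = 0
  · refine ⟨f.coeff 0, 1, 0, fun hc => hf.ne_zero ?_, ?_⟩
    · rw [Polynomial.eq_C_of_natDegree_eq_zero h0, hc, Polynomial.C_0]
    · rw [mul_one, mul_zero, add_zero]
      exact Polynomial.eq_C_of_natDegree_eq_zero h0
  have hprim : f.IsPrimitive := hf.isPrimitive h0
  obtain ⟨a, b, -, -, hab⟩ := Polynomial.exists_mul_add_mul_eq_C_resultant f g le_rfl le_rfl
    (Or.inl h0)
  refine ⟨_, a, b, ?_, hab⟩
  -- By Gauss's lemma `f` stays irreducible over the fraction field and still does not divide `g`;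
  -- coprimality there makes the resultant nonzero.
  let K := FractionRing R
  have hirr : Irreducible (f.map (algebraMap R K)) :=
    hprim.irreducible_iff_irreducible_map_fraction_map.1 hf
  have hcop : IsCoprime (f.map (algebraMap R K)) (g.map (algebraMap R K)) :=
    hirr.coprime_iff_not_dvd.2 fun h => hfg (hprim.dvd_of_fraction_map_dvd_fraction_map h)
  have hres := Polynomial.resultant_ne_zero _ _ hcop
  have hinj : Function.Injective (algebraMap R K) := IsFractionRing.injective R K
  rw [Polynomial.natDegree_map_eq_of_injective hinj, Polynomial.natDegree_map_eq_of_injective hinj,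
    Polynomial.resultant_map_map] at hres
  exact fun h => hres (by rw [h, map_zero])

lemma finite_zeros_fin_one {c : MvPolynomial (Fin 1) ℂ} (hc : c ≠ 0) :
    {w : ℂ | eval (fun _ => w) c = 0}.Finite := by
  let φ : Polynomial ℂ := aeval (fun _ => Polynomial.X) c
  have hφ (w : ℂ) : φ.eval w = eval (fun _ => w) c := by
    have h := comp_aeval_apply (f := fun _ : Fin 1 => (Polynomial.X : Polynomial ℂ))
      (Polynomial.aeval w) c
    simp only [Polynomial.aeval_X, Polynomial.coe_aeval_eq_eval] at h
    exact h
  have hφ0 : φ ≠ 0 := by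
    intro h0
    refine hc (MvPolynomial.funext fun x => ?_)
    have h1 := hφ (x 0)
    have h2 : (fun _ => x 0) = x := by ext i; rw [Subsingleton.elim i 0]
    rw [h0, Polynomial.eval_zero, h2] at h1
    rw [map_zero, ← h1]
  refine (φ.rootSet_finite ℂ).subset fun w hw => ?_
  rw [Polynomial.mem_rootSet]
  exact ⟨hφ0, by simpa [hφ] using hw⟩

/-- Eliminating `z` leaves a nonzero polynomial in `w` that vanishes at the second coordinate of
every common zero. -/
lemma finite_snd_of_common_zeros {f g : Poly2} (hf : Irreducible f) (hfg : ¬ f ∣ g) :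
    {w : ℂ | ∃ z, ev f z w = 0 ∧ ev g z w = 0}.Finite := by
  let e := finSuccEquiv ℂ 1
  have he : Irreducible (e f) := (MulEquiv.irreducible_iff e).2 hf
  obtain ⟨c, a, b, hc, h⟩ := exists_mul_add_mul_eq_C he
    (g := e g) fun h => hfg ((map_dvd_iff e).1 h)
  refine (finite_zeros_fin_one hc).subset ?_
  rintro w ⟨z, hz, hw⟩
  have hev (p : Poly2) : ev p z w = Polynomial.eval z (Polynomial.map (eval fun _ => w) (e p)) := by
    rw [← eval_eq_eval_mv_eval', ev]
    congr 2
    ext i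
    fin_cases i <;> rfl
  rw [hev] at hz hw
  have := congrArg (fun p => Polynomial.eval z (Polynomial.map (eval fun _ => w) p)) h
  simpa [hz, hw] using this.symm

/-- An irreducible polynomial in two variables and a polynomial that it does not divide have
finitely many common zeros. -/
lemma finite_common_zeros {f g : Poly2} (hf : Irreducible f) (hfg : ¬ f ∣ g) :
    {x : ℂ × ℂ | ev f x.1 x.2 = 0 ∧ ev g x.1 x.2 = 0}.Finite := by
  let e : Poly2 ≃ₐ[ℂ] Poly2 := renameEquiv ℂ (Equiv.swap 0 1)
  have hev (p : Poly2) (z w : ℂ) : ev (e p) z w = ev p w z := by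
    rw [ev, renameEquiv_apply, eval_rename, ev]
    congr 2
    ext i
    fin_cases i <;> simp
  have h1 := finite_snd_of_common_zeros hf hfg
  have h2 := finite_snd_of_common_zeros (f := e f) (g := e g)
    ((MulEquiv.irreducible_iff e).2 hf) fun h => hfg ((map_dvd_iff e).1 h)
  refine (h2.prod h1).subset ?_
  rintro ⟨z, w⟩ ⟨hz, hw⟩
  exact ⟨⟨w, by rwa [hev], by rwa [hev]⟩, ⟨z, hz, hw⟩⟩

lemma finite_common_zeros_of_forall_irreducible {q g : Poly2} (hq : q ≠ 0)
    (h : ∀ f, Irreducible f → f ∣ q → ¬ f ∣ g) :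
    {x : ℂ × ℂ | ev q x.1 x.2 = 0 ∧ ev g x.1 x.2 = 0}.Finite := by
  classical
  have hfin : (⋃ f ∈ (UniqueFactorizationMonoid.factors q).toFinset,
      {x : ℂ × ℂ | ev f x.1 x.2 = 0 ∧ ev g x.1 x.2 = 0}).Finite := by
    refine Set.Finite.biUnion (Finset.finite_toSet _) fun f hf => ?_
    rw [Finset.mem_coe, Multiset.mem_toFinset] at hf
    have hirr := UniqueFactorizationMonoid.irreducible_of_factor f hf
    exact finite_common_zeros hirr (h f hirr (UniqueFactorizationMonoid.dvd_of_mem_factors hf))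
  refine hfin.subset ?_
  rintro ⟨z, w⟩ ⟨hz, hw⟩
  have hprod := (UniqueFactorizationMonoid.factors_prod hq).map (eval ![z, w])
  have h0 : eval ![z, w] q = 0 := hz
  rw [h0, associated_zero_iff_eq_zero, map_multiset_prod, Multiset.prod_eq_zero_iff,
    Multiset.mem_map] at hprod
  obtain ⟨f, hf, hf0⟩ := hprod
  simp only [Set.mem_iUnion]
  exact ⟨f, Multiset.mem_toFinset.2 hf, hf0, hw⟩

/-- The weighted Euler derivation `a z ∂/∂z + b w ∂/∂w`. -/
noncomputable def eulerDerivation (a b : ℝ) : Derivation ℂ Poly2 Poly2 :=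
  (C (a : ℂ) * X 0 : Poly2) • pderiv 0 + (C (b : ℂ) * X 1 : Poly2) • pderiv 1

lemma eulerDerivation_apply (a b : ℝ) (f : Poly2) : eulerDerivation a b f
    = C (a : ℂ) * X 0 * pderiv 0 f + C (b : ℂ) * X 1 * pderiv 1 f := rfl

lemma ev_eulerDerivation (a b : ℝ) (f : Poly2) (z w : ℂ) : ev (eulerDerivation a b f) z w
    = a * z * ev (pderiv 0 f) z w + b * w * ev (pderiv 1 f) z w := by
  simp [eulerDerivation_apply, ev]

lemma coeff_eulerDerivation (a b : ℝ) (k : Fin 2 →₀ ℕ) (f : Poly2) :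
    coeff k (eulerDerivation a b f) = (a * k 0 + b * k 1) * coeff k f := by
  have := mem_of_monomial_mem (N := LinearMap.eqLocus
    (lcoeff ℂ k ∘ₗ (eulerDerivation a b : Poly2 →ₗ[ℂ] Poly2))
    ((a * k 0 + b * k 1 : ℂ) • lcoeff ℂ k)) (fun l => ?_) f
  · exact this
  have h (i : Fin 2) (c : ℂ) : (C c * X i * pderiv i (monomial l 1) : Poly2)
      = monomial l (c * l i) := by
    rw [pderiv_monomial, C_mul_X_eq_monomial, monomial_mul, one_mul]
    by_cases hl : l i = 0
    · simp [hl]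
    · rw [add_tsub_cancel_of_le]
      rwa [Finsupp.single_le_iff, Nat.one_le_iff_ne_zero]
  have h' : eulerDerivation a b (monomial l 1) = monomial l ((a : ℂ) * l 0 + b * l 1) := by
    rw [eulerDerivation_apply, h, h, ← map_add]
  change coeff k (eulerDerivation a b (monomial l 1)) = (a * k 0 + b * k 1) * coeff k (monomial l 1)
  rw [h', coeff_monomial, coeff_monomial]
  split_ifs with hl
  · rw [hl, mul_one]
  · rw [mul_zero]

/-- A polynomial that does not vanish at the origin and divides its weighted Euler derivative is
annihilated by the weighted Euler derivation. -/
lemma eulerDerivation_eq_zero_of_dvd {a b : ℝ} {f : Poly2} (h0 : coeff 0 f ≠ 0)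
    (h : f ∣ eulerDerivation a b f) : eulerDerivation a b f = 0 := by
  obtain ⟨g, hg⟩ := h
  by_contra hne
  have hf : f ≠ 0 := fun hf => h0 (by rw [hf, coeff_zero])
  have hg0 : g ≠ 0 := fun hg0 => hne (by rw [hg, hg0, mul_zero])
  have hdeg : (eulerDerivation a b f).totalDegree ≤ f.totalDegree := by
    refine totalDegree_le_of_support_subset fun k hk => ?_
    rw [mem_support_iff, coeff_eulerDerivation] at hk
    exact mem_support_iff.2 (right_ne_zero_of_mul hk)
  -- The derivation does not raise the total degree, so the quotient `g` is constant. The derivative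
  -- has no constant term while `f` has one, which forces `g = 0`.
  rw [hg, totalDegree_mul_of_isDomain hf hg0] at hdeg
  have hgC := totalDegree_eq_zero_iff_eq_C.1 (by lia : g.totalDegree = 0)
  have hc := coeff_eulerDerivation a b 0 f
  rw [hg, hgC, mul_comm f, coeff_C_mul] at hc
  have : coeff 0 g = 0 := by simpa [h0] using hc
  rw [this, C_0] at hgC
  exact hg0 hgC

lemma not_dvd_eulerDerivation {q : Poly2} (h0 : coeff 0 q ≠ 0) {a b : ℝ} (ha : 0 ≤ a) (hb : 0 ≤ b)
    (hab : ¬(a = 0 ∧ b = 0)) (hsq : Squarefree q)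
    (hqa : a = 0 → ∀ f : Poly2, f ∣ q → degreeOf 1 f = 0 → degreeOf 0 f = 0)
    (hqb : b = 0 → ∀ f : Poly2, f ∣ q → degreeOf 0 f = 0 → degreeOf 1 f = 0)
    (f : Poly2) (hf : Irreducible f) (hfq : f ∣ q) : ¬ f ∣ eulerDerivation a b q := by
  intro hdvd
  obtain ⟨g, rfl⟩ := hfq
  have hfg : ¬ f ∣ g := fun hd => hf.not_isUnit (hsq f (mul_dvd_mul_left f hd))
  have hc : coeff 0 f ≠ 0 := by
    rw [← constantCoeff_eq, map_mul] at h0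
    exact left_ne_zero_of_mul h0
  have hdf : f ∣ eulerDerivation a b f := by
    rw [Derivation.leibniz, smul_eq_mul, smul_eq_mul, dvd_add_right (dvd_mul_right _ _)] at hdvd
    exact (hf.prime.dvd_or_dvd hdvd).resolve_left hfg
  have hzero := eulerDerivation_eq_zero_of_dvd hc hdf
  have hk (k : Fin 2 →₀ ℕ) (hk : k ∈ f.support) : a * k 0 = 0 ∧ b * k 1 = 0 := by
    have h1 := coeff_eulerDerivation a b k f
    rw [hzero, coeff_zero, eq_comm, mul_eq_zero, or_iff_left (mem_support_iff.1 hk)] at h1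
    have h2 : a * k 0 + b * k 1 = 0 := by exact_mod_cast h1
    -- Nonnegativity of both weights separates the two variables.
    exact (add_eq_zero_iff_of_nonneg (by positivity) (by positivity)).1 h2
  have d0 : a ≠ 0 → degreeOf 0 f = 0 := fun ha0 => Nat.le_zero.1 (degreeOf_le_iff.2 fun k hk' => by
    simpa [ha0] using (hk k hk').1)
  have d1 : b ≠ 0 → degreeOf 1 f = 0 := fun hb0 => Nat.le_zero.1 (degreeOf_le_iff.2 fun k hk' => by
    simpa [hb0] using (hk k hk').2)
  have hd : degreeOf 0 f = 0 ∧ degreeOf 1 f = 0 := by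
    by_cases ha0 : a = 0
    · have hb0 : b ≠ 0 := fun hb0 => hab ⟨ha0, hb0⟩
      exact ⟨hqa ha0 f (dvd_mul_right _ _) (d1 hb0), d1 hb0⟩
    · refine ⟨d0 ha0, ?_⟩
      by_cases hb0 : b = 0
      · exact hqb hb0 f (dvd_mul_right _ _) (d0 ha0)
      · exact d1 hb0
  have hfC : f = C (coeff 0 f) := by
    ext k
    rw [coeff_C]
    split_ifs with hk0
    · rw [hk0]
    · by_contra hne
      refine hk0 ?_
      have hks := mem_support_iff.2 hne
      ext i
      fin_cases i
      · exact (Nat.le_zero.1 (degreeOf_le_iff.1 hd.1.le k hks)).symm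
      · exact (Nat.le_zero.1 (degreeOf_le_iff.1 hd.2.le k hks)).symm
  refine hf.not_isUnit ?_
  rw [hfC]
  exact (isUnit_iff_ne_zero.2 hc).map C

/-- The weighted Euler derivative vanishes at the common zeros. -/
lemma ev_eulerDerivation_eq_zero {q : Poly2} {n m : ℕ} {a b : ℝ} {A : Fin n → Poly2}
    {B : Fin m → Poly2} (h : IsSOSPair q n m a b A B) {x : ℂ × ℂ} (hx : x ∈ commonZeros q A B) :
    ev (eulerDerivation a b q) x.1 x.2 = 0 := by
  obtain ⟨z, w⟩ := x
  obtain ⟨hq, hA, hB⟩ := hx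
  simp only at hq hA hB ⊢
  set l := ev (eulerDerivation a b q) z w with hl
  -- Differentiate the identity in the direction `(α, β)`. The right side has derivative zero
  -- because the squares vanish to second order; on the left, `q = 0` leaves only the term where
  -- `conj q` is differentiated.
  have key (α β : ℂ) :
      (l * star (α * ev (pderiv 0 q) z w + β * ev (pderiv 1 q) z w)).re = 0 := by
    have hu (z α : ℂ) : HasDerivAt (fun t : ℝ => z + t * α) α 0 := by
      simpa using ((hasDerivAt_id (0 : ℝ)).ofReal_comp.mul_const α).const_add z
    have hvec {k : ℕ} (P : Fin k → Poly2) (hP : ∀ i, ev (P i) z w = 0) :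
        HasDerivAt (fun t : ℝ => vecNormSq P (z + t * α) (w + t * β)) 0 0 := by
      have := HasDerivAt.fun_sum (u := Finset.univ) fun i _ =>
        hasDerivAt_norm_sq_ev (P i) (hu z α) (hu w β)
      simpa [vecNormSq, hP] using this
    have hone (z α : ℂ) : ∃ d, HasDerivAt (fun t : ℝ => 1 - ‖z + t * α‖ ^ 2) d 0 :=
      ⟨_, (hu z α).norm_sq.const_sub 1⟩
    obtain ⟨d₁, hd₁⟩ := hone z α
    obtain ⟨d₂, hd₂⟩ := hone w β
    have hR := (hd₁.mul (hvec A hA)).add (hd₂.mul (hvec B hB))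
    have hN := (hasDerivAt_norm_sq_ev q (hu z α) (hu w β)).const_mul (a * n + b * m)
    have hL := hasDerivAt_ev (eulerDerivation a b q) (hu z α) (hu w β)
    have hQ := (hasDerivAt_ev q (hu z α) (hu w β)).star
    have hP := ((Complex.reCLM.hasFDerivAt.comp_hasDerivAt (0 : ℝ) (hL.mul hQ))).const_mul 2
    have hE := hN.sub hP
    have hfun := hE.unique (hR.congr_of_eventuallyEq (Filter.Eventually.of_forall fun t => ?_))
    · simpa [hq, vecNormSq, hA, hB, ← hl] using hfun
    · have := h.2.2 (z + t * α) (w + t * β)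
      rw [← ev_eulerDerivation] at this
      exact this
  by_contra hne
  -- This direction makes the expression equal to `|l|² |∇q|²`. Thus `l = 0` or the gradient
  -- vanishes, and in the latter case `l = 0` again.
  have h1 := key (l * star (ev (pderiv 0 q) z w)) (l * star (ev (pderiv 1 q) z w))
  have e : l * star (l * star (ev (pderiv 0 q) z w) * ev (pderiv 0 q) z w
      + l * star (ev (pderiv 1 q) z w) * ev (pderiv 1 q) z w)
      = ((‖l‖ ^ 2 * (‖ev (pderiv 0 q) z w‖ ^ 2 + ‖ev (pderiv 1 q) z w‖ ^ 2) : ℝ) : ℂ) := by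
    have hn (c : ℂ) : ((‖c‖ ^ 2 : ℝ) : ℂ) = c * star c := by
      rw [← Complex.normSq_eq_norm_sq]; exact (Complex.mul_conj c).symm
    rw [Complex.ofReal_mul, Complex.ofReal_add, hn, hn, hn, star_add, star_mul', star_mul',
      star_mul', star_mul', star_star, star_star]
    ring
  rw [e, Complex.ofReal_re, mul_eq_zero, or_iff_right (by simpa using hne),
    add_eq_zero_iff_of_nonneg (by positivity) (by positivity)] at h1
  refine hne ?_
  have h2 : ev (pderiv 0 q) z w = 0 := by simpa using h1.1
  have h3 : ev (pderiv 1 q) z w = 0 := by simpa using h1.2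
  rw [hl, ev_eulerDerivation, h2, h3, mul_zero, mul_zero, add_zero]

theorem finite_commonZeros {q : Poly2} {n m : ℕ} (hzero : NoZerosOnBidisk q) {a b : ℝ}
    (ha : 0 ≤ a) (hb : 0 ≤ b) (hab : ¬(a = 0 ∧ b = 0)) (hsq : Squarefree q)
    (hqa : a = 0 → ∀ f : Poly2, f ∣ q → degreeOf 1 f = 0 → degreeOf 0 f = 0)
    (hqb : b = 0 → ∀ f : Poly2, f ∣ q → degreeOf 0 f = 0 → degreeOf 1 f = 0)
    {A : Fin n → Poly2} {B : Fin m → Poly2} (h : IsSOSPair q n m a b A B) :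
    (commonZeros q A B).Finite := by
  have h0 : coeff 0 q ≠ 0 := by
    have := hzero 0 0 (by simp) (by simp)
    have hz : ![(0 : ℂ), 0] = 0 := by simp
    rwa [ev, hz, eval_zero, constantCoeff_eq] at this
  refine (finite_common_zeros_of_forall_irreducible (q := q) (g := eulerDerivation a b q)
    hsq.ne_zero (not_dvd_eulerDerivation h0 ha hb hab hsq hqa hqb)).subset fun x hx => ?_
  exact ⟨hx.1, ev_eulerDerivation_eq_zero h hx⟩

end Finiteness

end BidiskSOS

theorem mainTheorem5 (n m : ℕ) (q : BidiskSOS.Poly2)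
    (hdeg : BidiskSOS.HasDegree q n m)
    (hsymm : BidiskSOS.IsTorusSymmetric q n m)
    (hzero : BidiskSOS.NoZerosOnBidisk q)
    (a b : ℝ) (ha : 0 ≤ a) (hb : 0 ≤ b) (hab : ¬(a = 0 ∧ b = 0)) :
    (∃ (A : Fin n → BidiskSOS.Poly2) (B : Fin m → BidiskSOS.Poly2),
      BidiskSOS.IsSOSPair q n m a b A B) ∧
    (Squarefree q →
      (a = 0 → ∀ f : BidiskSOS.Poly2, f ∣ q → MvPolynomial.degreeOf 1 f = 0 →
        MvPolynomial.degreeOf 0 f = 0) →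
      (b = 0 → ∀ f : BidiskSOS.Poly2, f ∣ q → MvPolynomial.degreeOf 0 f = 0 →
        MvPolynomial.degreeOf 1 f = 0) →
      ∀ (A : Fin n → BidiskSOS.Poly2) (B : Fin m → BidiskSOS.Poly2),
        BidiskSOS.IsSOSPair q n m a b A B → (BidiskSOS.commonZeros q A B).Finite) := by
  exact ⟨BidiskSOS.exists_isSOSPair hdeg hsymm hzero ha hb,
    fun hsq hqa hqb _ _ h => BidiskSOS.finite_commonZeros hzero ha hb hab hsq hqa hqb h⟩
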